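/- \textbf{Setting.} Let $\mathcal{PT}$ be the set of planar rooted trees with vertices decorated by $\{1,\dots,n\}$, $\mathcal{OF}$ the real vector space with basis the ordered forests (words in $\mathcal{PT}$, with empty word $\mathbf 1$), and $|x|$ the number of vertices of $x$. For forests $A,B$ let $A\triangleright B$ be left grafting (the sum over all ways to graft each root of $A$ onto a vertex of $B$, to the left of the branches already present there, roots grafted onto the same vertex keeping their order), and let $A\ast B=A_{(1)}\cdot(A_{(2)}\triangleright B)$ be the planar Grossman--Larson product, where $\cdot$ is concatenation and $\Delta(A)=A_{(1)}\otimes A_{(2)}$ is the deshuffle coproduct of words. The MKW Hopf algebra is $\mathcal{OF}$ with the shuffle product and the coproduct graded dual to $\ast$. Let $0<\gamma\le 1$ and let $\mathbb X$ be a $\gamma$-regular rough path over it: for $s,t\in\mathbb R$, $\mathbb X_{st}:\mathcal{OF}\to\mathbb R$ is a unital character of the shuffle product, $\mathbb X_{su}\ast\mathbb X_{ut}=\mathbb X_{st}$, and $\sup_{s\ne t}|\langle\mathbb X_{st},x\rangle|\,|t-s|^{-\gamma|x|}<\infty$ for every forest $x$. Let $G$ be a (finite-dimensional, real) Lie group with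 Lie algebra $\mathfrak g$, acting smoothly and transitively on a smooth manifold $\mathcal M$. Elements $v\in\mathfrak g$ act on $C^\infty(\mathcal M)$ by $(v\psi)(p)=\frac{d}{dt}\big|_{t=0}\psi(\exp(-tv)\cdot p)$. This makes $C^\infty(\mathcal M)\otimes\mathcal U(\mathfrak g)$, a space of functions $\mathcal M\to\mathcal U(\mathfrak g)$, into a D-algebra with $(a\otimes u)\triangleright(b\otimes v)=a\,(ub)\otimes v$, on which also $A\ast B=A_{(1)}\cdot(A_{(2)}\triangleright B)$, with the coproduct of $\mathcal U(\mathfrak g)$ extended $C^\infty(\mathcal M)$-linearly; $a\otimes u$ acts on $C^\infty(\mathcal M)$ as the differential operator $\psi\mapsto a\cdot(u\psi)$. Let $f_1,\dots,f_n:\mathcal M\to\mathfrak g$ be smooth. \textbf{Maps.} Define $\varphi:\mathcal{OF}\to T(\mathcal{PT})$ by $\varphi(\mathbf 1)=\mathbf 1$ and $\varphi(\tau\cdot A)=\tau\cdot\varphi(A)-\varphi(\tau\triangleright A)$ for trees $\tau$ and forests $A$, and define $F_{\mathbf f}$ by $F_{\mathbf f}(\mathbf 1)=1$, $F_{\mathbf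 f}(\tau_1\cdots\tau_m)=F_{\mathbf f}(\tau_1)\cdots F_{\mathbf f}(\tau_m)$ and $F_{\mathbf f}(B_+^a(\omega))=F_{\mathbf f}(\omega)\triangleright f_a$. Then $\varphi$ is the identity on trees and an algebra isomorphism from $(\mathcal{OF},\ast)$ to $T(\mathcal{PT})$ with concatenation; and $F_{\mathbf f}:\mathcal{OF}\to C^\infty(\mathcal M)\otimes\mathcal U(\mathfrak g)$ is a morphism of D-algebras (it preserves the unit, the product $\cdot$ and $\triangleright$, and sends trees to $\mathfrak g$-valued functions) with $F_{\mathbf f}(\bullet_a)=f_a$. Let $\varphi(\mathbb X_{st})$ be the image of $\mathbb X_{st}=\sum_x\langle\mathbb X_{st},x\rangle x$ under $\varphi$, i.e. $\langle\varphi(\mathbb X_{st}),w\rangle=\sum_{|x|=|w|}\langle\mathbb X_{st},x\rangle\langle\varphi(x),w\rangle$. Let $\Lambda\subseteq\mathcal{PT}$ be any set of trees containing all trees with at most $N=\lfloor 1/\gamma\rfloor$ vertices (in particular, those trees themselves, $\Lambda=\{\tau_1,\dots,\tau_k\}$, or $\Lambda=\mathcal{PT}$). \textbf{Proposition.} The formal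 solution of the planarly branched equation $dY_{st}=\sum_i f_i(Y_{st})\,d\mathbb X_t$ and the solution of the geometric equation $d\overline Y_{st}=\sum_{\tau\in\Lambda} f_\tau(\overline Y_{st})\,d\varphi(\mathbb X_{st})$, in which $f_\tau$ is multiplication by $\tau$, coincide. That is, for all $s,t\in\mathbb R$, as formal series graded by the number of vertices (equality in each degree): \begin{enumerate} \item in $C^\infty(\mathcal M)\otimes\mathcal U(\mathfrak g)$, with $f_\tau$ the left multiplication $A\mapsto F_{\mathbf f}(\tau)\ast A$, \[\sum_{x}\langle\mathbb X_{st},x\rangle F_{\mathbf f}(x)=\sum_m\sum_{\sigma_1,\dots,\sigma_m\in\Lambda}\langle\varphi(\mathbb X_{st}),\sigma_1\cdots\sigma_m\rangle\, f_{\sigma_1}\cdots f_{\sigma_m}(1);\] \item for every $\psi\in C^\infty(\mathcal M)$ and initial value $y_0\in\mathcal M$, with $f_\tau$ the vector field (first-order differential operator) given by $F_{\mathbf f}(\tau)$, \[\sum_{x}\langle\mathbb X_{st},x\rangle (F_{\mathbf f}(x)\psi)(y_0)=\sum_m\sum_{\sigma_1,\dots,\sigma_m\in\Lambda}\langle\varphi(\mathbb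 X_{st}),\sigma_1\cdots\sigma_m\rangle\,(f_{\sigma_1}\cdots f_{\sigma_m}\psi)(y_0);\] \item in the completed Grossman--Larson algebra, \[\sum_x\langle\mathbb X_{st},x\rangle x=\sum_m\sum_{\sigma_1,\dots,\sigma_m\in\Lambda}\langle\varphi(\mathbb X_{st}),\sigma_1\cdots\sigma_m\rangle\,\sigma_1\ast\cdots\ast\sigma_m;\] \item in the completed tensor algebra over $\mathcal{PT}$, \[\varphi\Big(\sum_x\langle\mathbb X_{st},x\rangle x\Big)=\sum_m\sum_{\sigma_1,\dots,\sigma_m\in\Lambda}\langle\varphi(\mathbb X_{st}),\sigma_1\cdots\sigma_m\rangle\,\sigma_1\cdots\sigma_m.\] \end{enumerate} -/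

import Mathlib

set_option linter.unusedSectionVars false

open scoped Manifold ContDiff TensorProduct

noncomputable section

namespace PlanarRP

/-! ## Planar forests, left grafting, the planar Grossman--Larson product -/

/-- Planar rooted trees with vertices decorated by `C`: `node a [τ₁, …, τₘ]` is
`B₊ᵃ(τ₁ ⋯ τₘ)`, the branches being listed from left to right. -/
inductive PTree (C : Type*) : Type _
  | node (a : C) (θ : List (PTree C)) : PTree C

/-- Ordered forests; they are also the words in the alphabet of planar trees. -/
abbrev Forest (C : Type*) : Type _ := List (PTree C)

section Combinatorics

variable {C : Type*}

mutual
/-- Number of vertices of a tree. -/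
def PTree.size : PTree C → ℕ
  | .node _ θ => forestSize θ + 1
/-- Number of vertices of a forest. -/
def forestSize : List (PTree C) → ℕ
  | [] => 0
  | τ :: θ => τ.size + forestSize θ
end

/-- The deshuffle coproduct of a word `x₁ ⋯ xₘ`, as the list of its `2ᵐ` terms
`x_I ⊗ x_{Iᶜ}`. -/
def deshuffle {α : Type*} : List α → List (List α × List α)
  | [] => [([], [])]
  | x :: xs => (deshuffle xs).map (fun p => (x :: p.1, p.2)) ++
      (deshuffle xs).map (fun p => (p.1, x :: p.2))

/-- The shuffle product of two words, as the list of its terms. -/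
def shuffles {α : Type*} : List α → List α → List (List α)
  | [], ys => [ys]
  | x :: xs, [] => [x :: xs]
  | x :: xs, y :: ys =>
      (shuffles xs (y :: ys)).map (x :: ·) ++ (shuffles (x :: xs) ys).map (y :: ·)
termination_by xs ys => xs.length + ys.length

mutual
/-- The terms of `A ▷ τ`: all ways to graft every root of the forest `A` onto a vertex of the
tree `τ`, to the left of the branches of that vertex, roots grafted onto the same vertex keeping
their order. On `B₊ᵃ(θ)` one chooses which roots go to the root (`p.1`) and which go
higher (`p.2`). -/
def PTree.graft : PTree C → Forest C → List (PTree C)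
  | .node a θ, A => (deshuffle A).flatMap fun p =>
      (forestGraft θ p.2).map fun θ' => .node a (p.1 ++ θ')
/-- The terms of `A ▷ θ` for a forest `θ`: the roots of `A` are distributed over the trees
of `θ`; nothing nonempty can be grafted onto the empty forest. -/
def forestGraft : List (PTree C) → Forest C → List (Forest C)
  | [], [] => [[]]
  | [], _ :: _ => []
  | τ :: θ, A => (deshuffle A).flatMap fun p =>
      (τ.graft p.1).flatMap fun τ' => (forestGraft θ p.2).map fun θ' => τ' :: θ'
end

/-- The terms of the planar Grossman--Larson product `A ∗ B = A₍₁₎ · (A₍₂₎ ▷ B)`. -/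
def glTerms (A B : Forest C) : List (Forest C) :=
  (deshuffle A).flatMap fun p => (forestGraft B p.2).map fun B' => p.1 ++ B'

/-- The vector space spanned by the ordered forests. -/
abbrev OF (C : Type*) : Type _ := Forest C →₀ ℝ

/-- The bilinear product on `OF C` whose value on two forests is the sum of a list of forests. -/
def bilin (op : Forest C → Forest C → List (Forest C)) : OF C →ₗ[ℝ] OF C →ₗ[ℝ] OF C :=
  Finsupp.lsum ℝ fun x => LinearMap.toSpanSingleton ℝ _
    (Finsupp.lsum ℝ fun y => LinearMap.toSpanSingleton ℝ _
      ((op x y).map fun z => Finsupp.single z (1 : ℝ)).sum)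

/-- The empty forest, the unit of all the products below. -/
def emptyForest : OF C := Finsupp.single [] 1

/-- A tree, as an element of `OF C`. -/
def ofTree (τ : PTree C) : OF C := Finsupp.single [τ] 1

/-- Concatenation, the product of the tensor algebra over the planar trees. -/
def concat : OF C →ₗ[ℝ] OF C →ₗ[ℝ] OF C := bilin fun x y => [x ++ y]

/-- Left grafting `x ▷ y`. -/
def graft : OF C →ₗ[ℝ] OF C →ₗ[ℝ] OF C := bilin fun x y => forestGraft y x

/-- The planar Grossman--Larson product `x ∗ y`. -/
def gl : OF C →ₗ[ℝ] OF C →ₗ[ℝ] OF C := bilin glTerms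

/-- The shuffle product, the product of the Munthe-Kaas--Wright Hopf algebra. -/
def shuffle : OF C →ₗ[ℝ] OF C →ₗ[ℝ] OF C := bilin shuffles

theorem finite_forestSize_eq [Finite C] (k : ℕ) : {θ : Forest C | forestSize θ = k}.Finite := by
  induction k using Nat.strong_induction_on with
  | _ k ih =>
    have hfin : (⋃ i : Fin k, ⋃ j : Fin k,
        (fun q : C × Forest C × Forest C => PTree.node q.1 q.2.1 :: q.2.2) ''
          (Set.univ ×ˢ ({θ : Forest C | forestSize θ = i} ×ˢ
            {θ : Forest C | forestSize θ = j}))).Finite := by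
      refine Set.finite_iUnion fun i => Set.finite_iUnion fun j => Set.Finite.image _ ?_
      exact Set.finite_univ.prod ((ih i i.2).prod (ih j j.2))
    refine (hfin.union (Set.finite_singleton [])).subset ?_
    rintro θ hθ
    match θ, hθ with
    | [], _ => exact Or.inr rfl
    | .node a θ₁ :: θ₂, hθ =>
      left
      have hθ' : forestSize θ₁ + 1 + forestSize θ₂ = k := by
        simpa [forestSize, PTree.size] using hθ
      simp only [Set.mem_iUnion]
      exact ⟨⟨forestSize θ₁, by omega⟩, ⟨forestSize θ₂, by omega⟩, (a, θ₁, θ₂),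
        ⟨trivial, rfl, rfl⟩, rfl⟩

/-- The finite set of all ordered forests with `k` vertices. -/
def forests (C : Type*) [Finite C] (k : ℕ) : Finset (Forest C) :=
  (finite_forestSize_eq (C := C) k).toFinset

/-- The Munthe-Kaas--Wright coproduct, graded dual to the planar Grossman--Larson product:
the coefficient of `x ⊗ y` in `Δ z` is the coefficient of `z` in `x ∗ y`. -/
def mkwCoproduct [Finite C] : OF C →ₗ[ℝ] OF C ⊗[ℝ] OF C :=
  Finsupp.linearCombination ℝ fun z =>
    ∑ ij ∈ Finset.HasAntidiagonal.antidiagonal (forestSize z), ∑ x ∈ forests C ij.1, ∑ y ∈ forests C ij.2,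
      gl (Finsupp.single x 1) (Finsupp.single y 1) z •
        (Finsupp.single x (1 : ℝ) ⊗ₜ[ℝ] Finsupp.single y (1 : ℝ))

/-- Convolution of linear forms on the Munthe-Kaas--Wright Hopf algebra. -/
def convolution [Finite C] (α β : OF C →ₗ[ℝ] ℝ) : OF C →ₗ[ℝ] ℝ :=
  LinearMap.mul' ℝ ℝ ∘ₗ TensorProduct.map α β ∘ₗ mkwCoproduct

/-- `phiAux m θ` is `φ θ` for forests `θ` of at most `m` trees: the recursion
`φ(τ · A) = τ · φ(A) - φ(τ ▷ A)`, i.e. `φ(τ ∗ A) = φ(τ) · φ(A)`. -/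
def phiAux : ℕ → Forest C → OF C
  | _, [] => emptyForest
  | 0, _ :: _ => 0
  | m + 1, τ :: A => concat (ofTree τ) (phiAux m A) -
      ((forestGraft A [τ]).map (phiAux m)).sum

/-- The map `φ` from the planar Grossman--Larson algebra to the tensor algebra over the planar
trees. -/
def phi : OF C →ₗ[ℝ] OF C := Finsupp.linearCombination ℝ fun θ => phiAux θ.length θ

/-- `φ` is the identity on trees and an isomorphism of algebras from the Grossman--Larson product
to concatenation. -/
structure IsGLIsomorphism (φ : OF C →ₗ[ℝ] OF C) : Prop where
  map_one : φ emptyForest = emptyForest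
  map_tree : ∀ τ : PTree C, φ (ofTree τ) = ofTree τ
  map_gl : ∀ x y : OF C, φ (gl x y) = concat (φ x) (φ y)
  bijective : Function.Bijective φ

/-- `φ` applied to a linear form `X`, seen as the element `∑ X(x) x` of the completion of the
Grossman--Larson algebra (`φ` preserves the number of vertices): the coefficient of
the word `w` in `φ(X)` is `∑_{|x| = |w|} X(x) ⟨φ(x), w⟩`. -/
def phiForm [Finite C] (X : OF C →ₗ[ℝ] ℝ) : OF C →ₗ[ℝ] ℝ :=
  Finsupp.linearCombination ℝ fun w =>
    ∑ x ∈ forests C (forestSize w), X (Finsupp.single x 1) * phi (Finsupp.single x 1) w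

end Combinatorics

/-! ## Planarly branched rough paths and formal solutions -/

/-- A `γ`-regular rough path over the Munthe-Kaas--Wright Hopf algebra of planar forests decorated
by `{1, …, n}`. -/
structure PlanarlyBranchedRoughPath (n : ℕ) (γ : ℝ) where
  form : ℝ → ℝ → (OF (Fin n) →ₗ[ℝ] ℝ)
  map_one : ∀ s t, form s t emptyForest = 1
  map_shuffle : ∀ s t x y, form s t (shuffle x y) = form s t x * form s t y
  chen : ∀ s u t, convolution (form s u) (form u t) = form s t
  bound : ∀ θ : Forest (Fin n), ∃ K : ℝ, ∀ s t : ℝ, s ≠ t →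
    |form s t (Finsupp.single θ 1)| / |t - s| ^ (γ * forestSize θ) ≤ K

section Solutions

variable {n : ℕ} {A : Type*} [AddCommGroup A] [Module ℝ A]

/-- The formal series `∑_x ⟨X, x⟩ F(x)` over all ordered forests, given by its homogeneous
components: the `k`-th one is the sum over the forests with `k` vertices. -/
def planarSolution (F : OF (Fin n) →ₗ[ℝ] A) (X : OF (Fin n) →ₗ[ℝ] ℝ) (k : ℕ) : A :=
  ∑ x ∈ forests (Fin n) k, X (Finsupp.single x 1) • F (Finsupp.single x 1)

open Classical in
/-- The formal solution `∑_w ⟨X, τ_{i₁} ⋯ τ_{iₘ}⟩ f_{τ_{i₁}} ⋯ f_{τ_{iₘ}} y₀` of the geometric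
equation `dY = ∑_{τ ∈ letters} f_τ(Y) dX`, `Y_{ss} = y₀`, driven by a family of linear forms on
words of trees: the sum is over all words in the given letters; a letter `τ` has weight `|τ|`, and
the `k`-th component collects the words of total weight `k`. -/
def geometricSolution (letters : Set (PTree (Fin n))) (f : PTree (Fin n) → Module.End ℝ A)
    (y₀ : A) (X : OF (Fin n) →ₗ[ℝ] ℝ) (k : ℕ) : A :=
  ∑ w ∈ forests (Fin n) k with ∀ τ ∈ w, τ ∈ letters,
    X (Finsupp.single w 1) • (w.map f).prod y₀

end Solutions

/-! ## The D-algebra `C^∞(M) ⊗ U(𝔤)` -/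

section DAlgebra

attribute [local instance] LieRing.ofAssociativeRing LieAlgebra.ofAssociativeAlgebra

section Coproduct

variable (L : Type*) [LieRing L] [LieAlgebra ℝ L]

/-- The universal enveloping algebra. -/
abbrev U : Type _ := UniversalEnvelopingAlgebra ℝ L

/-- `x ↦ x ⊗ 1 + 1 ⊗ x`. -/
def primitiveLie : L →ₗ⁅ℝ⁆ U L ⊗[ℝ] U L where
  toFun x := UniversalEnvelopingAlgebra.ι ℝ x ⊗ₜ[ℝ] 1 + 1 ⊗ₜ[ℝ] UniversalEnvelopingAlgebra.ι ℝ x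
  map_add' x y := by simp only [map_add, TensorProduct.add_tmul, TensorProduct.tmul_add]; abel
  map_smul' c x := by simp [TensorProduct.smul_tmul', TensorProduct.tmul_smul]
  map_lie' := by
    intro x y
    simp only [LieHom.map_lie, LieRing.of_associative_ring_bracket, TensorProduct.sub_tmul,
      TensorProduct.tmul_sub, add_mul, mul_add, Algebra.TensorProduct.tmul_mul_tmul, mul_one,
      one_mul]
    abel

/-- The (unshuffle) coproduct of the universal enveloping algebra. -/
def envCoproduct : U L →ₐ[ℝ] U L ⊗[ℝ] U L :=
  UniversalEnvelopingAlgebra.lift ℝ (primitiveLie L)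

end Coproduct

section Products

variable {R L : Type*} [CommRing R] [Algebra ℝ R] [LieRing L] [LieAlgebra ℝ L]
  (act : L →ₗ⁅ℝ⁆ Module.End ℝ R)

/-- The differential operator on functions represented by an element of `R ⊗ U(L)`:
`a ⊗ u` acts by `h ↦ a · (u h)`. -/
def diffOp : R ⊗[ℝ] U L →ₗ[ℝ] Module.End ℝ R :=
  TensorProduct.lift ((LinearMap.mul ℝ (Module.End ℝ R)).compl₁₂ (Algebra.lmul ℝ R).toLinearMap
    (UniversalEnvelopingAlgebra.lift ℝ act).toLinearMap)

/-- The D-algebra product `A ▷ B`, differentiation of `U(L)`-valued functions: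
`(a ⊗ u) ▷ (b ⊗ v) = a (u b) ⊗ v`. -/
def triangle : R ⊗[ℝ] U L →ₗ[ℝ] R ⊗[ℝ] U L →ₗ[ℝ] R ⊗[ℝ] U L :=
  LinearMap.rTensorHom (U L) ∘ₗ diffOp act

/-- `u ∗ B = u₍₁₎ · (u₍₂₎ ▷ B)` for a constant `u ∈ U(L)`. -/
def starConst : U L →ₗ[ℝ] Module.End ℝ (R ⊗[ℝ] U L) :=
  TensorProduct.lift ((LinearMap.mul ℝ (Module.End ℝ (R ⊗[ℝ] U L))).compl₁₂
      ((Algebra.lmul ℝ (R ⊗[ℝ] U L)).toLinearMap ∘ₗ TensorProduct.mk ℝ R (U L) 1)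
      (triangle act ∘ₗ TensorProduct.mk ℝ R (U L) 1)) ∘ₗ (envCoproduct L).toLinearMap

/-- The product `A ∗ B = A₍₁₎ · (A₍₂₎ ▷ B)`, where the coproduct is linear over functions:
`(a ⊗ u) ∗ B = (a ⊗ 1) · (u ∗ B)`. -/
def star : R ⊗[ℝ] U L →ₗ[ℝ] R ⊗[ℝ] U L →ₗ[ℝ] R ⊗[ℝ] U L :=
  TensorProduct.lift ((LinearMap.mul ℝ (Module.End ℝ (R ⊗[ℝ] U L))).compl₁₂
      ((Algebra.lmul ℝ (R ⊗[ℝ] U L)).toLinearMap ∘ₗ (TensorProduct.mk ℝ R (U L)).flip 1)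
      (starConst act))

variable (R L) in
/-- The subspace `R ⊗ L` of `L`-valued functions. -/
def lieValued : Submodule ℝ (R ⊗[ℝ] U L) :=
  LinearMap.range (TensorProduct.map LinearMap.id
    (UniversalEnvelopingAlgebra.ι ℝ (L := L)).toLinearMap : R ⊗[ℝ] L →ₗ[ℝ] R ⊗[ℝ] U L)

variable {C : Type*} (f : C → R ⊗[ℝ] U L)

mutual
/-- Elementary differentials: `F_f(B₊ᵃ(θ)) = F_f(θ) ▷ f_a`. -/
def treeDifferential : PTree C → R ⊗[ℝ] U L
  | .node a θ => triangle act (forestDifferential θ) (f a)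
/-- `F_f(τ₁ ⋯ τₘ) = F_f(τ₁) ⋯ F_f(τₘ)`. -/
def forestDifferential : List (PTree C) → R ⊗[ℝ] U L
  | [] => 1
  | τ :: θ => treeDifferential τ * forestDifferential θ
end

/-- The map `F_f` from ordered forests to `U(L)`-valued functions. -/
def elementaryDifferential : OF C →ₗ[ℝ] R ⊗[ℝ] U L :=
  Finsupp.linearCombination ℝ (forestDifferential act f)

/-- `F` is a morphism of D-algebras with `F(•_a) = f_a`. -/
structure IsDAlgebraMorphism (F : OF C →ₗ[ℝ] R ⊗[ℝ] U L) : Prop where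
  map_vertex : ∀ a, F (ofTree (.node a [])) = f a
  map_one : F emptyForest = 1
  map_concat : ∀ x y, F (concat x y) = F x * F y
  map_graft : ∀ x y, F (graft x y) = triangle act (F x) (F y)
  map_tree : ∀ τ : PTree C, F (ofTree τ) ∈ lieValued R L

end Products

/-! ### The infinitesimal action on a homogeneous space -/

section HomogeneousSpace

open VectorField Bundle

instance minSmoothness_three_leInfty : ENat.LEInfty (minSmoothness ℝ 3) :=
  ⟨by rw [minSmoothness_of_isRCLikeNormedField]; exact_mod_cast ENat.LEInfty.out⟩

variable {E : Type*} [NormedAddCommGroup E] [NormedSpace ℝ E] [FiniteDimensional ℝ E]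
  {G : Type*} [TopologicalSpace G] [ChartedSpace E G] [Group G] [LieGroup 𝓘(ℝ, E) ∞ G]

theorem mvfderiv_lie (x y : GroupLieAlgebra 𝓘(ℝ, E) G) {h : G → ℝ}
    (hh : ContMDiff 𝓘(ℝ, E) 𝓘(ℝ, ℝ) ∞ h)
    (hx : MDifferentiable 𝓘(ℝ, E) 𝓘(ℝ, ℝ)
      fun g => mvfderiv 𝓘(ℝ, E) h g (mulInvariantVectorField x g))
    (hy : MDifferentiable 𝓘(ℝ, E) 𝓘(ℝ, ℝ)
      fun g => mvfderiv 𝓘(ℝ, E) h g (mulInvariantVectorField y g)) :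
    mvfderiv 𝓘(ℝ, E) h 1 ⁅x, y⁆ =
      mvfderiv 𝓘(ℝ, E) (fun g => mvfderiv 𝓘(ℝ, E) h g (mulInvariantVectorField y g)) 1 x -
      mvfderiv 𝓘(ℝ, E) (fun g => mvfderiv 𝓘(ℝ, E) h g (mulInvariantVectorField x g)) 1 y := by
  have : CompleteSpace E := FiniteDimensional.complete ℝ E
  have one (z : GroupLieAlgebra 𝓘(ℝ, E) G) : mulInvariantVectorField z 1 = z := by
    simp only [mulInvariantVectorField]
    have : (fun a : G => 1 * a) = id := by ext; simp
    rw [this, mfderiv_id]; rfl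
  rcases subsingleton_or_nontrivial E with hE | hE
  · have z0 (z : GroupLieAlgebra 𝓘(ℝ, E) G) : z = 0 := Subsingleton.elim (α := E) _ _
    rw [z0 ⁅x,y⁆, z0 x, z0 y]; simp
  obtain ⟨z, hz⟩ := exists_ne (0 : E)
  let z' : GroupLieAlgebra 𝓘(ℝ, E) G := z
  obtain ⟨Z, hZ⟩ : ∃ Z : Π g : G, TangentSpace 𝓘(ℝ, E) g, Z = mulInvariantVectorField z' :=
    ⟨_, rfl⟩
  have dh : MDifferentiable 𝓘(ℝ, E) 𝓘(ℝ, ℝ) h := hh.mdifferentiable (by simp)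
  have dI (w : GroupLieAlgebra 𝓘(ℝ, E) G) (g : G) :
      MDifferentiableAt 𝓘(ℝ, E) 𝓘(ℝ, E).tangent
        (fun g => (mulInvariantVectorField w g : TangentBundle 𝓘(ℝ, E) G)) g :=
    mdifferentiableAt_mulInvariantVectorField w
  have dB (u w : GroupLieAlgebra 𝓘(ℝ, E) G) (g : G) :
      MDifferentiableAt 𝓘(ℝ, E) 𝓘(ℝ, E).tangent
        (fun g => (mlieBracket 𝓘(ℝ, E) (mulInvariantVectorField u)
          (mulInvariantVectorField w) g : TangentBundle 𝓘(ℝ, E) G)) g := by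
    rw [← mulInvariantVector_mlieBracket]; exact dI _ g
  have dZ (g : G) : MDifferentiableAt 𝓘(ℝ, E) 𝓘(ℝ, E).tangent
      (fun g => (Z g : TangentBundle 𝓘(ℝ, E) G)) g := hZ ▸ dI z' g
  have dBZ (u : GroupLieAlgebra 𝓘(ℝ, E) G) (g : G) :
      MDifferentiableAt 𝓘(ℝ, E) 𝓘(ℝ, E).tangent
        (fun g => (mlieBracket 𝓘(ℝ, E) (mulInvariantVectorField u) Z g :
          TangentBundle 𝓘(ℝ, E) G)) g := by subst hZ; exact dB u z' g
  have key (w : GroupLieAlgebra 𝓘(ℝ, E) G) :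
      mlieBracket 𝓘(ℝ, E) (mulInvariantVectorField w) (h • Z) =
        (fun g => mvfderiv 𝓘(ℝ, E) h g (mulInvariantVectorField w g)) • Z +
          h • mlieBracket 𝓘(ℝ, E) (mulInvariantVectorField w) Z := by
    funext g
    exact mlieBracket_smul_right (dh g) (dZ g)
  have key2 (u w : GroupLieAlgebra 𝓘(ℝ, E) G)
      (hw : MDifferentiable 𝓘(ℝ, E) 𝓘(ℝ, ℝ)
        fun g => mvfderiv 𝓘(ℝ, E) h g (mulInvariantVectorField w g)) :
      mlieBracket 𝓘(ℝ, E) (mulInvariantVectorField u)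
        (mlieBracket 𝓘(ℝ, E) (mulInvariantVectorField w) (h • Z)) 1 =
      (mvfderiv 𝓘(ℝ, E) (fun g => mvfderiv 𝓘(ℝ, E) h g (mulInvariantVectorField w g)) 1 u • Z 1 +
        mvfderiv 𝓘(ℝ, E) h 1 w • mlieBracket 𝓘(ℝ, E) (mulInvariantVectorField u) Z 1) +
      (mvfderiv 𝓘(ℝ, E) h 1 u • mlieBracket 𝓘(ℝ, E) (mulInvariantVectorField w) Z 1 +
        h 1 • mlieBracket 𝓘(ℝ, E) (mulInvariantVectorField u)
          (mlieBracket 𝓘(ℝ, E) (mulInvariantVectorField w) Z) 1) := by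
    rw [key, mlieBracket_add_right, mlieBracket_smul_right (hw 1) (dZ 1),
      mlieBracket_smul_right (dh 1) (dBZ w 1)]
    · rw [one u, one w]
    · exact (hw 1).smul_section (dZ 1)
    · exact (dh 1).smul_section (dBZ w 1)
  have cI (w : GroupLieAlgebra 𝓘(ℝ, E) G) := contMDiff_mulInvariantVectorField w
  have cZ : ContMDiffAt 𝓘(ℝ, E) 𝓘(ℝ, E).tangent (minSmoothness ℝ 2)
      (fun g => (Z g : TangentBundle 𝓘(ℝ, E) G)) 1 := hZ ▸ cI z' 1
  have chZ : ContMDiffAt 𝓘(ℝ, E) 𝓘(ℝ, E).tangent (minSmoothness ℝ 2)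
      (fun g => ((h • Z) g : TangentBundle 𝓘(ℝ, E) G)) 1 := by
    refine ContMDiffAt.smul_section ((hh 1).of_le ?_) cZ
    rw [minSmoothness_of_isRCLikeNormedField]; exact ENat.LEInfty.out
  have J1 := leibniz_identity_mlieBracket_apply (cI x 1) (cI y 1) chZ
  have J2 := leibniz_identity_mlieBracket_apply (cI x 1) (cI y 1) cZ
  have e1 : mlieBracket 𝓘(ℝ, E) (mlieBracket 𝓘(ℝ, E) (mulInvariantVectorField x)
        (mulInvariantVectorField y)) (h • Z) 1 =
      mvfderiv 𝓘(ℝ, E) h 1 ⁅x, y⁆ • Z 1 +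
        h 1 • mlieBracket 𝓘(ℝ, E) (mlieBracket 𝓘(ℝ, E) (mulInvariantVectorField x)
        (mulInvariantVectorField y)) Z 1 :=
    mlieBracket_smul_right (dh 1) (dZ 1)
  rw [key2 x y hy, key2 y x hx, e1, J2] at J1
  have hz1 : Z 1 ≠ 0 := by rw [hZ, one]; exact hz
  refine smul_left_injective ℝ hz1 ?_
  simp only [sub_smul]
  simp only [smul_add] at J1
  rw [eq_sub_iff_add_eq, ← sub_eq_zero]
  rw [eq_comm, ← sub_eq_zero] at J1
  rw [← J1]
  abel

variable {F : Type*} [NormedAddCommGroup F] [NormedSpace ℝ F]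
  {M : Type*} [TopologicalSpace M] [ChartedSpace F M] [IsManifold 𝓘(ℝ, F) ∞ M]
  [MulAction G M] [ContMDiffSMul 𝓘(ℝ, E) 𝓘(ℝ, F) ∞ G M]

theorem contMDiff_invSMul : ContMDiff (𝓘(ℝ, E).prod 𝓘(ℝ, F)) 𝓘(ℝ, F) ∞
    (fun q : G × M => q.1⁻¹ • q.2) := by
  have h1 : ContMDiff (𝓘(ℝ, E).prod 𝓘(ℝ, F)) (𝓘(ℝ, E).prod 𝓘(ℝ, F)) ∞
    (fun q : G × M => (q.1⁻¹, q.2)) :=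
    ((contMDiff_inv 𝓘(ℝ, E) ∞).comp contMDiff_fst).prodMk contMDiff_snd
  exact (contMDiff_smul (I := 𝓘(ℝ, E)) (I' := 𝓘(ℝ, F)) (n := ∞) (G := G) (M := M)).comp h1

theorem contMDiff_actionDeriv (x : GroupLieAlgebra 𝓘(ℝ, E) G) (f : C^∞⟮𝓘(ℝ, F), M; ℝ⟯) :
    ContMDiff 𝓘(ℝ, F) 𝓘(ℝ, ℝ) ∞
      (fun p : M => mvfderiv 𝓘(ℝ, E) (fun g : G => f (g⁻¹ • p)) 1 x) := by
  have hΦ : ContMDiff (𝓘(ℝ, E).prod 𝓘(ℝ, F)) 𝓘(ℝ, ℝ) ∞ (fun q : G × M => f (q.1⁻¹ • q.2)) :=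
    f.contMDiff.comp contMDiff_invSMul
  let F₁ : M → TangentBundle 𝓘(ℝ, E) G × TangentBundle 𝓘(ℝ, F) M :=
    fun p => (TotalSpace.mk' E 1 x, TotalSpace.mk' F p 0)
  have S₁ : ContMDiff 𝓘(ℝ, F) (𝓘(ℝ, E).tangent.prod 𝓘(ℝ, F).tangent) ∞ F₁ :=
    contMDiff_const.prodMk (contMDiff_zeroSection _ _)
  have S₂ := contMDiff_equivTangentBundleProd_symm (I := 𝓘(ℝ, E)) (M := G) (I' := 𝓘(ℝ, F))
    (M' := M) (n := ∞)
  have S₃ := ContMDiff.contMDiff_tangentMap hΦ (m := ∞) (by simp)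
  have S₄ := contMDiff_snd_tangentBundle_modelSpace ℝ 𝓘(ℝ, ℝ) (n := ∞)
  have S := ((S₄.comp S₃).comp S₂).comp S₁
  convert S using 1
  funext p
  have hd : MDifferentiable (𝓘(ℝ, E).prod 𝓘(ℝ, F)) 𝓘(ℝ, ℝ)
      (fun q : G × M => f (q.1⁻¹ • q.2)) := hΦ.mdifferentiable (by simp)
  have e := mfderiv_prod_eq_add_apply (v := ((x, (0 : F)) : TangentSpace (𝓘(ℝ, E).prod 𝓘(ℝ, F))
    ((1, p) : G × M))) (hd (1, p))
  refine Eq.trans ?_ e.symm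
  refine (?_ : mvfderiv 𝓘(ℝ, E) (fun g : G => f (g⁻¹ • p)) 1 x = _).trans
    (add_zero _).symm |>.trans (congrArg₂ (· + ·) rfl ?_)
  · rfl
  · exact (map_zero _).symm

/-- Infinitesimal action of `x ∈ 𝔤 = T₁G` on functions:
`(x f)(p) = d/dt|₀ f(exp(-t x) • p)`. The inverse makes this a morphism of Lie algebras for the
bracket of left-invariant vector fields. -/
def actionDeriv (x : GroupLieAlgebra 𝓘(ℝ, E) G) (f : C^∞⟮𝓘(ℝ, F), M; ℝ⟯) :
    C^∞⟮𝓘(ℝ, F), M; ℝ⟯ :=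
  ⟨fun p => mvfderiv 𝓘(ℝ, E) (fun g : G => f (g⁻¹ • p)) 1 x, contMDiff_actionDeriv x f⟩

theorem contMDiff_orbit (f : C^∞⟮𝓘(ℝ, F), M; ℝ⟯) (p : M) :
    ContMDiff 𝓘(ℝ, E) 𝓘(ℝ, ℝ) ∞ (fun g : G => f (g⁻¹ • p)) :=
  (f.contMDiff.comp (contMDiff_invSMul (E := E) (F := F))).comp
    (contMDiff_id.prodMk contMDiff_const)

theorem mvfderiv_orbit (x : GroupLieAlgebra 𝓘(ℝ, E) G) (f : C^∞⟮𝓘(ℝ, F), M; ℝ⟯) (p : M)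
    (g : G) :
    mvfderiv 𝓘(ℝ, E) (fun g : G => f (g⁻¹ • p)) g (mulInvariantVectorField x g) =
      actionDeriv x f (g⁻¹ • p) := by
  have hd : MDifferentiable 𝓘(ℝ, E) 𝓘(ℝ, ℝ) (fun g : G => f (g⁻¹ • p)) :=
    (contMDiff_orbit f p).mdifferentiable (by simp)
  have hL : MDifferentiable 𝓘(ℝ, E) 𝓘(ℝ, E) (fun a : G => g * a) :=
    (contMDiff_mul_left (n := ∞)).mdifferentiable (by simp)
  have e := mvfderiv_comp_of_eq (f := fun a : G => g * a) (g := fun g : G => f (g⁻¹ • p))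
    (x := 1) (y := g) (hd g) (hL 1) (mul_one g)
  have e2 : (fun g : G => f (g⁻¹ • p)) ∘ (fun a : G => g * a) =
      fun a : G => f (a⁻¹ • g⁻¹ • p) := by
    funext a; simp [mul_smul]
  rw [e2] at e
  have e3 := congrArg (fun L => L x) e
  refine Eq.trans ?_ e3.symm
  simp only [ContinuousLinearMap.comp_apply, mulInvariantVectorField]
  rw [mul_one]

/-- The Lie algebra of `G` acting on the smooth functions on `M` by vector fields. -/
def infinitesimalAction : GroupLieAlgebra 𝓘(ℝ, E) G →ₗ⁅ℝ⁆ Module.End ℝ C^∞⟮𝓘(ℝ, F), M; ℝ⟯ where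
  toFun x :=
    { toFun := actionDeriv x
      map_add' := fun f h => by
        ext p
        exact congrArg (fun L => L x) (mvfderiv_add
          ((contMDiff_orbit f p).mdifferentiable (by simp) 1)
          ((contMDiff_orbit h p).mdifferentiable (by simp) 1))
      map_smul' := fun c f => by
        ext p
        have := congrArg (fun L => L x) (mvfderiv_smul (I := 𝓘(ℝ, E)) (x := (1 : G)) (a := fun _ => c)
          mdifferentiableAt_const
          ((contMDiff_orbit f p).mdifferentiable (by simp) 1))
        refine Eq.trans ?_ (this.trans ?_)
        · rfl
        · have hc : mvfderiv 𝓘(ℝ, E) (fun _ : G => c) 1 = 0 := mvfderiv_const c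
          rw [hc]; simp; exact Or.inl rfl }
  map_add' x y := by
    ext f p; exact (mvfderiv 𝓘(ℝ, E) (fun g : G => f (g⁻¹ • p)) 1).map_add x y
  map_smul' c x := by
    ext f p; exact (mvfderiv 𝓘(ℝ, E) (fun g : G => f (g⁻¹ • p)) 1).map_smul c x
  map_lie' := by
    intro x y
    ext f p
    have hxy (z : GroupLieAlgebra 𝓘(ℝ, E) G) :
        (fun g : G => mvfderiv 𝓘(ℝ, E) (fun g : G => f (g⁻¹ • p)) g (mulInvariantVectorField z g)) =
        fun g : G => actionDeriv z f (g⁻¹ • p) := funext fun g => mvfderiv_orbit z f p g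
    have hd (z : GroupLieAlgebra 𝓘(ℝ, E) G) :
        MDifferentiable 𝓘(ℝ, E) 𝓘(ℝ, ℝ) (fun g : G => actionDeriv z f (g⁻¹ • p)) :=
      (contMDiff_orbit (actionDeriv z f) p).mdifferentiable (by simp)
    have e := mvfderiv_lie x y (contMDiff_orbit f p) (by rw [hxy]; exact hd x)
      (by rw [hxy]; exact hd y)
    rw [hxy, hxy] at e
    exact e

/-- A smooth map `M → 𝔤`, seen in `C^∞(M) ⊗ U(𝔤)`; as a vector space `𝔤 = T₁G` is the
model space `E`. -/
def ofLieValuedMap (f : C^∞⟮𝓘(ℝ, F), M; 𝓘(ℝ, E), E⟯) :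
    C^∞⟮𝓘(ℝ, F), M; ℝ⟯ ⊗[ℝ] U (GroupLieAlgebra 𝓘(ℝ, E) G) :=
  ∑ k, (⟨fun p => (Module.finBasis ℝ E).coord k (f p),
      ((Module.finBasis ℝ E).coord k).toContinuousLinearMap.contMDiff.comp f.contMDiff⟩ :
        C^∞⟮𝓘(ℝ, F), M; ℝ⟯) ⊗ₜ[ℝ]
    UniversalEnvelopingAlgebra.ι ℝ (Module.finBasis ℝ E k : GroupLieAlgebra 𝓘(ℝ, E) G)

variable (G) in
/-- The map `F_f : OF → C^∞(M) ⊗ U(𝔤)` attached to smooth maps `fᵢ : M → 𝔤`. -/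
def flowMap {C : Type*} (f : C → C^∞⟮𝓘(ℝ, F), M; 𝓘(ℝ, E), E⟯) :
    OF C →ₗ[ℝ] C^∞⟮𝓘(ℝ, F), M; ℝ⟯ ⊗[ℝ] U (GroupLieAlgebra 𝓘(ℝ, E) G) :=
  elementaryDifferential infinitesimalAction fun a => ofLieValuedMap (f a)

end HomogeneousSpace

end DAlgebra

end PlanarRP

end

-- When `Λ` is the set of all trees, the identities express that `φ` is an isomorphism. The inverse
-- of `φ` sends a word `τ₁ ⋯ τₘ` to `τ₁ ∗ ⋯ ∗ τₘ`, so expanding `φ(𝕏)` in words and applying a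
-- linear map `Ψ` with `Ψ(τ · x) = f_τ(Ψ x)` yields the geometric solution with operators `f_τ`. The
-- four statements are four choices of `Ψ`: `F_f ∘ φ⁻¹`, the same followed by the action on `ψ`,
-- `φ⁻¹`, and the identity (`geometricSolution_eq_map`).
--
-- Algebraically, everything rests on left multiplication by one tree, `τ ∗ x = τ · x + τ ▷ x`,
-- where `τ ▷ ·` is a derivation of concatenation. Both summands are coderivations of the deshuffle
-- coproduct, which gives `(τ ∗ x) ▷ y = τ ▷ (x ▷ y)` and `(τ ∗ x) ∗ y = τ ∗ (x ∗ y)` (`graft_gl`,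
-- `gl_assoc_ofTree`). Trees generate under `∗`, so multiplicativity of `φ` and compatibility of
-- `F_f` with `▷` need checking only for a tree on the left. On the analytic side, the values
-- `F_f(τ)` are Lie-valued, hence primitive and acting as derivations, and they satisfy the same
-- relations.
--
-- To shrink `Λ`, it must be shown that `φ(𝕏)` has no component on words with a letter `τ`, `|τ| >
-- ⌊1/γ⌋` (`PlanarlyBranchedRoughPath.phiForm_eq_zero`). As `φ` is multiplicative, Chen's relation
-- for `𝕏` becomes deconcatenation for `φ(𝕏)`. By induction on the length of the word, all proper
-- cuts contribute zero, so the coefficient is additive over intervals; it is also `O(|t - s|^p)`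
-- with `p > 1`, and therefore vanishes.

noncomputable section

namespace PlanarRP

-- Left multiplication by a tree in the Grossman–Larson algebra

section GrossmanLarson

variable {C : Type*}

theorem OF.hom_ext {V : Type*} [AddCommMonoid V] [Module ℝ V] {f g : OF C →ₗ[ℝ] V}
    (h : ∀ x, f (Finsupp.single x 1) = g (Finsupp.single x 1)) : f = g :=
  Finsupp.lhom_ext' fun x => LinearMap.ext_ring (h x)

theorem map_listSum {α V W : Type*} [AddCommMonoid V] [Module ℝ V] [AddCommMonoid W]
    [Module ℝ W] (f : V →ₗ[ℝ] W) (l : List α) (g : α → V) :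
    f (l.map g).sum = (l.map fun x => f (g x)).sum := by
  rw [map_list_sum, List.map_map]; rfl

theorem listSum_flatMap {α β V : Type*} [AddCommMonoid V] (l : List α) (g : α → List β)
    (h : β → V) : ((l.flatMap g).map h).sum = (l.map fun x => ((g x).map h).sum).sum := by
  induction l with
  | nil => rfl
  | cons x l ih => simp [ih]

theorem listSum_add {α V : Type*} [AddCommMonoid V] (l : List α) (g h : α → V) :
    (l.map fun x => g x + h x).sum = (l.map g).sum + (l.map h).sum :=
  List.sum_map_add

theorem bilin_single (op : Forest C → Forest C → List (Forest C)) (x y : Forest C) :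
    bilin op (Finsupp.single x 1) (Finsupp.single y 1) =
      ((op x y).map fun z => Finsupp.single z (1 : ℝ)).sum := by
  simp [bilin]

@[simp] theorem concat_single (x y : Forest C) :
    concat (Finsupp.single x 1) (Finsupp.single y 1) = Finsupp.single (x ++ y) (1 : ℝ) := by
  simp [concat, bilin_single]

theorem concat_assoc (x y z : OF C) : concat (concat x y) z = concat x (concat y z) := by
  induction x using Finsupp.induction_linear with
  | zero => simp
  | add x x' hx hx' => simp only [map_add, LinearMap.add_apply, hx, hx']
  | single x a =>
  induction y using Finsupp.induction_linear with
  | zero => simp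
  | add x x' hx hx' => simp only [map_add, LinearMap.add_apply, hx, hx']
  | single y b =>
  induction z using Finsupp.induction_linear with
  | zero => simp
  | add x x' hx hx' => simp only [map_add, hx, hx']
  | single z c =>
  rw [← mul_one a, ← mul_one b, ← mul_one c]
  simp only [← smul_eq_mul, ← Finsupp.smul_single, map_smul, LinearMap.smul_apply, concat_single,
    List.append_assoc]

@[simp] theorem emptyForest_concat (x : OF C) : concat emptyForest x = x :=
  LinearMap.congr_fun (OF.hom_ext (f := concat emptyForest) (g := LinearMap.id)
    fun y => by simp [emptyForest]) x

@[simp] theorem concat_emptyForest (x : OF C) : concat x emptyForest = x :=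
  LinearMap.congr_fun (OF.hom_ext (f := concat.flip emptyForest) (g := LinearMap.id)
    fun y => by simp [emptyForest]) x

mutual
@[simp] theorem PTree.graft_nil : ∀ τ : PTree C, τ.graft [] = [τ]
  | .node a θ => by simp [PTree.graft, deshuffle, forestGraft_nil θ]
@[simp] theorem forestGraft_nil : ∀ θ : Forest C, forestGraft θ [] = [θ]
  | [] => by simp [forestGraft]
  | τ :: θ => by simp [forestGraft, deshuffle, PTree.graft_nil τ, forestGraft_nil θ]
end

theorem forestGraft_cons_tree (τ t : PTree C) (θ : Forest C) :
    forestGraft (t :: θ) [τ] = ((t.graft [τ]).map fun t' => t' :: θ) ++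
      (forestGraft θ [τ]).map fun θ' => t :: θ' := by
  simp [forestGraft, deshuffle, ← List.map_eq_flatMap]

theorem PTree.graft_tree (τ : PTree C) (a : C) (θ : Forest C) :
    (PTree.node a θ).graft [τ] =
      .node a (τ :: θ) :: (forestGraft θ [τ]).map fun θ' => .node a θ' := by
  simp [PTree.graft, deshuffle]

/-- Left grafting of a single tree `τ`. -/
def graftTree (τ : PTree C) : Module.End ℝ (OF C) := graft (ofTree τ)

theorem graftTree_single (τ : PTree C) (θ : Forest C) :
    graftTree τ (Finsupp.single θ 1) =
      ((forestGraft θ [τ]).map fun z => Finsupp.single z (1 : ℝ)).sum := by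
  rw [graftTree, ofTree, graft, bilin_single]

theorem graftTree_cons (τ t : PTree C) (θ : Forest C) :
    graftTree τ (Finsupp.single (t :: θ) 1) =
      concat (graftTree τ (ofTree t)) (Finsupp.single θ 1) +
        concat (ofTree t) (graftTree τ (Finsupp.single θ 1)) := by
  rw [ofTree, graftTree_single, graftTree_single, graftTree_single, forestGraft_cons_tree,
    forestGraft_cons_tree, ← LinearMap.flip_apply, map_listSum, map_listSum]
  simp [forestGraft, Function.comp_def]

theorem graftTree_emptyForest (τ : PTree C) : graftTree τ emptyForest = 0 := by
  rw [emptyForest, graftTree_single]; simp [forestGraft]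

/-- A single root lands on exactly one tree of the forest, so a Leibniz rule holds. -/
theorem graftTree_concat (τ : PTree C) (x y : OF C) :
    graftTree τ (concat x y) = concat (graftTree τ x) y + concat x (graftTree τ y) := by
  suffices h : ∀ x y : Forest C, graftTree τ (concat (Finsupp.single x 1) (Finsupp.single y 1)) =
      concat (graftTree τ (Finsupp.single x 1)) (Finsupp.single y 1) +
        concat (Finsupp.single x 1) (graftTree τ (Finsupp.single y 1)) by
    have e : concat.compr₂ (graftTree τ) = concat ∘ₗ graftTree τ + concat.compl₂ (graftTree τ) :=
      OF.hom_ext fun x => OF.hom_ext fun y => h x y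
    exact LinearMap.congr_fun (LinearMap.congr_fun e x) y
  intro x y
  induction x with
  | nil =>
    change graftTree τ (concat emptyForest _) = concat (graftTree τ emptyForest) _ +
      concat emptyForest _
    simp [graftTree_emptyForest]
  | cons t x ih =>
    have e : (Finsupp.single (t :: x) 1 : OF C) = concat (ofTree t) (Finsupp.single x 1) := by
      simp [ofTree]
    rw [concat_single, List.cons_append, graftTree_cons, ← concat_single, ih, graftTree_cons, e]
    simp only [map_add, LinearMap.add_apply, concat_assoc]
    abel

/-- A one-letter word is primitive for the deshuffle coproduct, so only two terms occur. -/
theorem gl_ofTree (τ : PTree C) : gl (ofTree τ) = concat (ofTree τ) + graftTree τ := by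
  refine OF.hom_ext fun x => ?_
  rw [LinearMap.add_apply, graftTree_single, ofTree, gl, bilin_single]
  simp [glTerms, deshuffle]

/-- The product of the tensor algebra, on the tensor square. -/
def concatMul : OF C ⊗[ℝ] OF C →ₗ[ℝ] OF C := TensorProduct.lift concat

/-- The deshuffle coproduct. -/
def deshuffleCoproduct : OF C →ₗ[ℝ] OF C ⊗[ℝ] OF C :=
  Finsupp.linearCombination ℝ fun x =>
    ((deshuffle x).map fun p => Finsupp.single p.1 (1 : ℝ) ⊗ₜ[ℝ] Finsupp.single p.2 (1 : ℝ)).sum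

theorem deshuffleCoproduct_single (x : Forest C) :
    deshuffleCoproduct (Finsupp.single x 1) = ((deshuffle x).map fun p =>
      Finsupp.single p.1 (1 : ℝ) ⊗ₜ[ℝ] Finsupp.single p.2 (1 : ℝ)).sum := by
  simp [deshuffleCoproduct]

/-- The derivation `T ⊗ id + id ⊗ T` of the tensor square. -/
def coderiv : Module.End ℝ (OF C) →ₗ[ℝ] Module.End ℝ (OF C ⊗[ℝ] OF C) :=
  LinearMap.rTensorHom (OF C) + LinearMap.lTensorHom (OF C)

theorem coderiv_tmul (T : Module.End ℝ (OF C)) (x y : OF C) :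
    coderiv T (x ⊗ₜ y) = T x ⊗ₜ y + x ⊗ₜ T y := rfl

theorem deshuffleCoproduct_concat_ofTree (τ : PTree C) :
    deshuffleCoproduct ∘ₗ concat (ofTree τ) = coderiv (concat (ofTree τ)) ∘ₗ deshuffleCoproduct := by
  refine OF.hom_ext fun x => ?_
  simp only [LinearMap.comp_apply, ofTree, concat_single, deshuffleCoproduct_single]
  rw [map_listSum]
  simp only [coderiv_tmul, listSum_add, concat_single]
  simp [deshuffle, Function.comp_def]

/-- The span of the single trees. -/
def treeSpan (C : Type*) : Submodule ℝ (OF C) := Submodule.span ℝ (Set.range ofTree)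

theorem graftTree_ofTree_mem (τ t : PTree C) : graftTree τ (ofTree t) ∈ treeSpan C := by
  rw [ofTree, graftTree_single, forestGraft_cons_tree]
  simp only [forestGraft, List.map_nil, List.append_nil, List.map_map]
  refine list_sum_mem fun v hv => ?_
  simp only [List.mem_map] at hv
  obtain ⟨t', -, rfl⟩ := hv
  exact Submodule.subset_span ⟨t', rfl⟩

/-- The span is needed rather than a single tree: grafting `τ` onto a tree gives a sum of trees,
still primitive. -/
theorem deshuffleCoproduct_concat {v : OF C} (hv : v ∈ treeSpan C) (x : OF C) :
    deshuffleCoproduct (concat v x) = coderiv (concat v) (deshuffleCoproduct x) := by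
  induction hv using Submodule.span_induction with
  | mem v hv =>
    obtain ⟨τ, rfl⟩ := hv
    exact LinearMap.congr_fun (deshuffleCoproduct_concat_ofTree τ) x
  | zero => simp
  | add v w _ _ hv hw => simp only [map_add, LinearMap.add_apply, hv, hw]
  | smul c v _ hv => simp only [map_smul, LinearMap.smul_apply, hv]

/-- The mixed terms `S ⊗ T` and `T ⊗ S` commute past each other, so `coderiv` respects commutators.
-/
theorem coderiv_comm (S T R : Module.End ℝ (OF C)) (h : S * T = T * S + R)
    (z : OF C ⊗[ℝ] OF C) :
    coderiv S (coderiv T z) = coderiv T (coderiv S z) + coderiv R z := by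
  have h' (x) : S (T x) = T (S x) + R x := LinearMap.congr_fun h x
  induction z with
  | zero => simp
  | add x y hx hy => simp only [map_add, hx, hy]; abel
  | tmul x y =>
    simp only [coderiv_tmul, map_add, h', TensorProduct.add_tmul, TensorProduct.tmul_add]; abel

theorem deshuffleCoproduct_graftTree (τ : PTree C) (x : OF C) :
    deshuffleCoproduct (graftTree τ x) = coderiv (graftTree τ) (deshuffleCoproduct x) := by
  refine LinearMap.congr_fun (OF.hom_ext (f := deshuffleCoproduct ∘ₗ graftTree τ)
    (g := coderiv (graftTree τ) ∘ₗ deshuffleCoproduct) fun x => ?_) x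
  simp only [LinearMap.comp_apply]
  induction x with
  | nil =>
    rw [← emptyForest, graftTree_emptyForest, emptyForest, deshuffleCoproduct_single]
    simp only [deshuffle, List.map_cons, List.map_nil, List.sum_cons, List.sum_nil, add_zero]
    rw [← emptyForest, coderiv_tmul, graftTree_emptyForest]
    simp
  | cons t x ih =>
    have e : (Finsupp.single (t :: x) 1 : OF C) = concat (ofTree t) (Finsupp.single x 1) := by
      simp [ofTree]
    have ht : ofTree t ∈ treeSpan C := Submodule.subset_span ⟨t, rfl⟩
    -- The derivation rule says that the commutator of `graftTree τ` with concatenation by `t` is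
    -- concatenation by `τ ▷ t`.
    rw [graftTree_cons, map_add, deshuffleCoproduct_concat (graftTree_ofTree_mem τ t),
      deshuffleCoproduct_concat ht, ih, e, deshuffleCoproduct_concat ht,
      coderiv_comm (graftTree τ) (concat (ofTree t)) (concat (graftTree τ (ofTree t))), add_comm]
    refine LinearMap.ext fun y => ?_
    simp only [Module.End.mul_apply, LinearMap.add_apply, graftTree_concat]
    abel

theorem deshuffleCoproduct_gl (τ : PTree C) (x : OF C) :
    deshuffleCoproduct (gl (ofTree τ) x) = coderiv (gl (ofTree τ)) (deshuffleCoproduct x) := by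
  have ht : ofTree τ ∈ treeSpan C := Submodule.subset_span ⟨τ, rfl⟩
  simp only [gl_ofTree, LinearMap.add_apply, map_add, deshuffleCoproduct_concat ht,
    deshuffleCoproduct_graftTree]

/-- `B₊ᵃ`, extended linearly. -/
def addRoot (a : C) : OF C →ₗ[ℝ] OF C :=
  Finsupp.linearCombination ℝ fun θ => ofTree (.node a θ)

theorem addRoot_single (a : C) (θ : Forest C) :
    addRoot a (Finsupp.single θ 1) = ofTree (.node a θ) := by simp [addRoot]

/-- Either `τ` becomes the leftmost branch at the root, giving `τ · x`, or it goes higher, giving `τ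
▷ x`. -/
theorem graftTree_addRoot (τ : PTree C) (a : C) (x : OF C) :
    graftTree τ (addRoot a x) = addRoot a (gl (ofTree τ) x) := by
  refine LinearMap.congr_fun (OF.hom_ext (f := graftTree τ ∘ₗ addRoot a)
    (g := addRoot a ∘ₗ gl (ofTree τ)) fun x => ?_) x
  simp only [LinearMap.comp_apply, gl_ofTree, LinearMap.add_apply, map_add, graftTree_single]
  rw [map_listSum, ofTree, concat_single, addRoot_single, addRoot_single, ofTree, ofTree,
    graftTree_single, forestGraft_cons_tree, PTree.graft_tree]
  simp [forestGraft, Function.comp_def, addRoot_single, ofTree]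

/-- The trees obtained by grafting a forest onto the tree `t`. -/
def graftOnTree (t : PTree C) : OF C →ₗ[ℝ] OF C :=
  Finsupp.linearCombination ℝ fun x => ((t.graft x).map ofTree).sum

theorem graftOnTree_single (t : PTree C) (x : Forest C) :
    graftOnTree t (Finsupp.single x 1) = ((t.graft x).map ofTree).sum := by
  simp [graftOnTree]

theorem graft_single_cons (x : OF C) (t : PTree C) (θ : Forest C) :
    graft x (Finsupp.single (t :: θ) 1) =
      concatMul (TensorProduct.map (graftOnTree t) (graft.flip (Finsupp.single θ 1))
        (deshuffleCoproduct x)) := by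
  refine LinearMap.congr_fun (OF.hom_ext (f := graft.flip (Finsupp.single (t :: θ) 1))
    (g := concatMul ∘ₗ TensorProduct.map (graftOnTree t) (graft.flip (Finsupp.single θ 1)) ∘ₗ
        deshuffleCoproduct) fun x => ?_) x
  simp only [LinearMap.comp_apply, deshuffleCoproduct_single, LinearMap.flip_apply]
  rw [map_listSum, map_listSum, graft, bilin_single, forestGraft, listSum_flatMap]
  congr 1
  refine List.map_congr_left fun p _ => ?_
  rw [TensorProduct.map_tmul, concatMul, TensorProduct.lift.tmul, LinearMap.flip_apply,
    bilin_single, graftOnTree_single, listSum_flatMap, ← LinearMap.flip_apply, map_listSum]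
  congr 1
  refine List.map_congr_left fun t' _ => ?_
  rw [LinearMap.flip_apply, map_listSum, List.map_map]
  simp [Function.comp_def, ofTree]

theorem gl_single_right (x : OF C) (θ : Forest C) :
    gl x (Finsupp.single θ 1) =
      concatMul (TensorProduct.map LinearMap.id (graft.flip (Finsupp.single θ 1))
        (deshuffleCoproduct x)) := by
  refine LinearMap.congr_fun (OF.hom_ext (f := gl.flip (Finsupp.single θ 1))
    (g := concatMul ∘ₗ TensorProduct.map LinearMap.id (graft.flip (Finsupp.single θ 1)) ∘ₗ
        deshuffleCoproduct) fun x => ?_) x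
  simp only [LinearMap.comp_apply, deshuffleCoproduct_single, LinearMap.flip_apply]
  rw [map_listSum, map_listSum, gl, bilin_single, glTerms, listSum_flatMap]
  congr 1
  refine List.map_congr_left fun p _ => ?_
  rw [TensorProduct.map_tmul, concatMul, TensorProduct.lift.tmul, LinearMap.flip_apply, graft,
    bilin_single, map_listSum, List.map_map]
  simp [Function.comp_def]

/-- The deshuffle in `PTree.graft` separates the roots attached to the new root from those grafted
higher, exactly as in the definition of `∗`. This ties grafting on a tree to associativity of `∗` on
its branches. -/
theorem graftOnTree_node (a : C) (θ : Forest C) (x : OF C) :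
    graftOnTree (.node a θ) x = addRoot a (gl x (Finsupp.single θ 1)) := by
  refine LinearMap.congr_fun (OF.hom_ext (f := graftOnTree (.node a θ))
    (g := addRoot a ∘ₗ gl.flip (Finsupp.single θ 1)) fun x => ?_) x
  rw [LinearMap.comp_apply, LinearMap.flip_apply, gl, bilin_single, glTerms, map_listSum,
    listSum_flatMap, graftOnTree_single, PTree.graft, listSum_flatMap]
  simp [Function.comp_def, addRoot_single]

theorem graftTree_concatMul (τ : PTree C) (z : OF C ⊗[ℝ] OF C) :
    graftTree τ (concatMul z) = concatMul (coderiv (graftTree τ) z) := by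
  induction z with
  | zero => simp
  | add x y hx hy => simp only [map_add, hx, hy]
  | tmul x y => simp [coderiv_tmul, concatMul, graftTree_concat]

/-- Stated for one fixed `θ` so that it can be used inside the structural induction of
`graft_gl_single`, where the grafting identity is known only for the branches. -/
theorem gl_assoc_of_graft {τ : PTree C} {θ : Forest C}
    (h : ∀ x, graft (gl (ofTree τ) x) (Finsupp.single θ 1) =
      graftTree τ (graft x (Finsupp.single θ 1))) (x : OF C) :
    gl (gl (ofTree τ) x) (Finsupp.single θ 1) = gl (ofTree τ) (gl x (Finsupp.single θ 1)) := by
  rw [gl_single_right, deshuffleCoproduct_gl, gl_single_right]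
  generalize deshuffleCoproduct x = z
  induction z with
  | zero => simp
  | add x y hx hy => simp only [map_add, hx, hy]
  | tmul x y =>
    simp only [coderiv_tmul, map_add, TensorProduct.map_tmul, concatMul, TensorProduct.lift.tmul,
      LinearMap.id_apply, LinearMap.flip_apply, h]
    simp only [gl_ofTree, LinearMap.add_apply, map_add, concat_assoc, graftTree_concat]
    abel

/-- Only the empty forest can be grafted onto the empty forest, so the counit appears. -/
theorem graft_emptyForest (x : OF C) : graft x emptyForest = x [] • emptyForest := by
  refine LinearMap.congr_fun (OF.hom_ext (f := graft.flip emptyForest)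
    (g := LinearMap.toSpanSingleton ℝ (OF C) emptyForest ∘ₗ Finsupp.lapply []) fun x => ?_) x
  simp only [LinearMap.flip_apply, emptyForest, graft, bilin_single]
  cases x <;> simp [forestGraft]

theorem graftTree_apply_nil (τ : PTree C) (x : OF C) : graftTree τ x [] = 0 := by
  refine LinearMap.congr_fun (OF.hom_ext (f := Finsupp.lapply [] ∘ₗ graftTree τ) (g := 0)
    fun x => ?_) x
  rw [LinearMap.comp_apply, graftTree_single, map_listSum]
  cases x with
  | nil => simp [forestGraft]
  | cons t x => simp [forestGraft_cons_tree, Function.comp_def]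

/-- The recursion calls itself on the branches of the first tree, where it yields associativity of
`∗` and hence the claim under `B₊ᵃ`, and on the remaining trees; the coderivation property of `τ ∗
·` combines the two. -/
theorem graft_gl_single (τ : PTree C) : ∀ (θ : Forest C) (x : OF C),
    graft (gl (ofTree τ) x) (Finsupp.single θ 1) = graftTree τ (graft x (Finsupp.single θ 1))
  | [], x => by
    refine LinearMap.congr_fun (OF.hom_ext (f := graft.flip (Finsupp.single [] 1) ∘ₗ gl (ofTree τ))
      (g := graftTree τ ∘ₗ graft.flip (Finsupp.single [] 1)) fun x => ?_) x
    simp only [LinearMap.comp_apply, LinearMap.flip_apply]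
    rw [← emptyForest, graft_emptyForest, graft_emptyForest, map_smul, graftTree_emptyForest,
      smul_zero, gl_ofTree, LinearMap.add_apply, Finsupp.add_apply, graftTree_apply_nil, ofTree,
      concat_single]
    simp
  | .node a θ :: θ', x => by
    have ih := graft_gl_single τ θ
    have ih' := graft_gl_single τ θ'
    rw [graft_single_cons, deshuffleCoproduct_gl, graft_single_cons, graftTree_concatMul]
    congr 1
    generalize deshuffleCoproduct x = z
    induction z with
    | zero => simp
    | add x y hx hy => simp only [map_add, hx, hy]
    | tmul x y =>
      simp only [coderiv_tmul, map_add, TensorProduct.map_tmul, LinearMap.flip_apply, ih',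
        graftOnTree_node, gl_assoc_of_graft ih, graftTree_addRoot]

theorem graft_gl (τ : PTree C) (x y : OF C) :
    graft (gl (ofTree τ) x) y = graftTree τ (graft x y) :=
  LinearMap.congr_fun (OF.hom_ext (f := graft (gl (ofTree τ) x)) (g := graftTree τ ∘ₗ graft x)
    fun θ => graft_gl_single τ θ x) y

theorem gl_assoc_ofTree (τ : PTree C) (x y : OF C) :
    gl (gl (ofTree τ) x) y = gl (ofTree τ) (gl x y) :=
  LinearMap.congr_fun (OF.hom_ext (f := gl (gl (ofTree τ) x)) (g := gl (ofTree τ) ∘ₗ gl x)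
    fun θ => gl_assoc_of_graft (graft_gl_single τ θ) x) y

end GrossmanLarson

-- The isomorphism `φ`

section Isomorphism

variable {C : Type*}

theorem length_of_mem_forestGraft (τ : PTree C) : ∀ {θ θ' : Forest C},
    θ' ∈ forestGraft θ [τ] → θ'.length = θ.length
  | [], θ', h => by simp [forestGraft] at h
  | t :: θ, θ', h => by
    rw [forestGraft_cons_tree, List.mem_append, List.mem_map, List.mem_map] at h
    rcases h with ⟨t', -, rfl⟩ | ⟨θ'', h, rfl⟩
    · rfl
    · simp [length_of_mem_forestGraft τ h]

theorem forestSize_of_mem_forestGraft (τ : PTree C) : ∀ {θ θ' : Forest C},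
    θ' ∈ forestGraft θ [τ] → forestSize θ' = τ.size + forestSize θ
  | [], θ', h => by simp [forestGraft] at h
  | .node a η :: θ, θ', h => by
    rw [forestGraft_cons_tree, PTree.graft_tree] at h
    simp only [List.mem_append, List.mem_map, List.mem_cons] at h
    rcases h with ⟨t', rfl | ⟨η', h, rfl⟩, rfl⟩ | ⟨θ'', h, rfl⟩
    · simp only [forestSize, PTree.size]; omega
    · have := forestSize_of_mem_forestGraft τ h
      simp only [forestSize, PTree.size]; omega
    · have := forestSize_of_mem_forestGraft τ h
      simp only [forestSize, PTree.size]; omega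

theorem single_cons_eq (τ : PTree C) (θ : Forest C) :
    (Finsupp.single (τ :: θ) 1 : OF C) =
      gl (ofTree τ) (Finsupp.single θ 1) - graftTree τ (Finsupp.single θ 1) := by
  rw [gl_ofTree, LinearMap.add_apply, add_sub_cancel_right, ofTree, concat_single]; rfl

/-- The trees generate the Grossman--Larson algebra. -/
theorem gl_induction {p : OF C → Prop} (zero : p 0) (add : ∀ x y, p x → p y → p (x + y))
    (smul : ∀ (c : ℝ) x, p x → p (c • x)) (one : p emptyForest)
    (mul : ∀ τ x, p x → p (gl (ofTree τ) x)) (x : OF C) : p x := by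
  let S : Submodule ℝ (OF C) :=
    { carrier := {x | p x}, add_mem' := fun h h' => add _ _ h h', zero_mem' := zero,
      smul_mem' := fun c _ h => smul c _ h }
  have key : ∀ (m : ℕ) (θ : Forest C), θ.length = m → Finsupp.single θ (1 : ℝ) ∈ S := by
    intro m
    induction m with
    | zero =>
      intro θ h
      rw [List.length_eq_zero_iff] at h
      exact h ▸ one
    | succ m ih =>
      rintro (_ | ⟨τ, θ⟩) h
      · simp at h
      have h : θ.length = m := by simpa using h
      -- In `τ · θ = τ ∗ θ - τ ▷ θ`, the last term has as many trees as `θ`; thus the induction on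
      -- the number of trees closes.
      rw [single_cons_eq, graftTree_single]
      refine S.sub_mem (mul τ _ (ih θ h)) (list_sum_mem fun v hv => ?_)
      obtain ⟨θ', hθ', rfl⟩ := List.mem_map.1 hv
      exact ih θ' ((length_of_mem_forestGraft τ hθ').trans h)
  change x ∈ S
  induction x using Finsupp.induction_linear with
  | zero => exact S.zero_mem
  | add x y hx hy => exact S.add_mem hx hy
  | single θ a =>
    rw [← mul_one a, ← smul_eq_mul, ← Finsupp.smul_single]
    exact S.smul_mem a (key _ θ rfl)

theorem phi_single (θ : Forest C) : phi (Finsupp.single θ 1) = phiAux θ.length θ := by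
  simp [phi]

theorem phi_emptyForest : phi (emptyForest : OF C) = emptyForest := by
  rw [emptyForest, phi_single, List.length_nil, phiAux, emptyForest]

theorem phi_single_cons (τ : PTree C) (θ : Forest C) :
    phi (Finsupp.single (τ :: θ) 1) = concat (ofTree τ) (phi (Finsupp.single θ 1)) -
      phi (graftTree τ (Finsupp.single θ 1)) := by
  rw [phi_single, List.length_cons, phiAux, phi_single, graftTree_single, map_listSum]
  congr 2
  refine List.map_congr_left fun θ' h => ?_
  rw [phi_single, length_of_mem_forestGraft τ h]

/-- This is the defining recursion of `φ` with the grafting term moved to the other side. -/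
theorem phi_gl_ofTree (τ : PTree C) (x : OF C) :
    phi (gl (ofTree τ) x) = concat (ofTree τ) (phi x) := by
  refine LinearMap.congr_fun (OF.hom_ext (f := phi ∘ₗ gl (ofTree τ))
    (g := concat (ofTree τ) ∘ₗ phi) fun θ => ?_) x
  rw [LinearMap.comp_apply, LinearMap.comp_apply, sub_eq_iff_eq_add.1 (single_cons_eq τ θ).symm,
    map_add, phi_single_cons, sub_add_cancel]

theorem gl_emptyForest_left (x : OF C) : gl emptyForest x = x := by
  refine LinearMap.congr_fun (OF.hom_ext (f := gl emptyForest)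
    (g := LinearMap.id) fun θ => ?_) x
  rw [emptyForest, gl, bilin_single]
  simp [glTerms, deshuffle]

theorem gl_emptyForest_ofTree (τ : PTree C) : gl (ofTree τ) emptyForest = ofTree τ := by
  rw [gl_ofTree, LinearMap.add_apply, graftTree_emptyForest, concat_emptyForest, add_zero]

theorem phi_gl (x y : OF C) : phi (gl x y) = concat (phi x) (phi y) := by
  induction x using gl_induction with
  | zero => simp
  | add x x' hx hx' => simp only [map_add, LinearMap.add_apply, hx, hx']
  | smul c x hx => simp only [map_smul, LinearMap.smul_apply, hx]
  | one => rw [gl_emptyForest_left, phi_emptyForest, emptyForest_concat]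
  | mul τ x hx => rw [gl_assoc_ofTree, phi_gl_ofTree, hx, phi_gl_ofTree, concat_assoc]

/-- The inverse of `phi`, sending a word `τ₁ ⋯ τₘ` to `τ₁ ∗ ⋯ ∗ τₘ`. -/
def phiInv : OF C →ₗ[ℝ] OF C :=
  Finsupp.linearCombination ℝ fun w => (w.map fun τ => gl (ofTree τ)).prod emptyForest

theorem phiInv_emptyForest : phiInv (emptyForest : OF C) = emptyForest := by
  simp [phiInv, emptyForest]

theorem phiInv_concat_ofTree (τ : PTree C) (x : OF C) :
    phiInv (concat (ofTree τ) x) = gl (ofTree τ) (phiInv x) := by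
  refine LinearMap.congr_fun (OF.hom_ext (f := phiInv ∘ₗ concat (ofTree τ))
    (g := gl (ofTree τ) ∘ₗ phiInv) fun θ => ?_) x
  simp [phiInv, ofTree]

theorem phiInv_phi (x : OF C) : phiInv (phi x) = x := by
  induction x using gl_induction with
  | zero => simp
  | add x x' hx hx' => simp only [map_add, hx, hx']
  | smul c x hx => simp only [map_smul, hx]
  | one => rw [phi_emptyForest, phiInv_emptyForest]
  | mul τ x hx => rw [phi_gl_ofTree, phiInv_concat_ofTree, hx]

theorem phi_phiInv (x : OF C) : phi (phiInv x) = x := by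
  refine LinearMap.congr_fun (OF.hom_ext (f := phi ∘ₗ phiInv) (g := LinearMap.id) fun w => ?_) x
  rw [LinearMap.comp_apply, LinearMap.id_apply]
  induction w with
  | nil => rw [← emptyForest, phiInv_emptyForest, phi_emptyForest]
  | cons τ w ih =>
    have e : (Finsupp.single (τ :: w) 1 : OF C) = concat (ofTree τ) (Finsupp.single w 1) := by
      simp [ofTree]
    rw [e, phiInv_concat_ofTree, phi_gl_ofTree, ih]

theorem isGLIsomorphism_phi : IsGLIsomorphism (phi (C := C)) where
  map_one := phi_emptyForest
  map_tree τ := by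
    rw [← gl_emptyForest_ofTree, phi_gl_ofTree, phi_emptyForest, concat_emptyForest,
      gl_emptyForest_ofTree]
  map_gl := phi_gl
  bijective := Function.bijective_iff_has_inverse.2 ⟨phiInv, phiInv_phi, phi_phiInv⟩

-- Grading and deconcatenation

theorem forestSize_append (x y : Forest C) : forestSize (x ++ y) = forestSize x + forestSize y := by
  induction x with
  | nil => simp [forestSize]
  | cons t x ih => rw [List.cons_append, forestSize, forestSize, ih, add_assoc]

/-- The value of `concat` at a word is a sum over its deconcatenations. -/
theorem concat_apply (x y : OF C) (w : Forest C) :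
    concat x y w = ∑ i ∈ Finset.range (w.length + 1), x (w.take i) * y (w.drop i) := by
  classical
  have e : concat.compr₂ (Finsupp.lapply w) = ∑ i ∈ Finset.range (w.length + 1),
      (LinearMap.mul ℝ ℝ).compl₁₂ (Finsupp.lapply (w.take i)) (Finsupp.lapply (w.drop i)) := by
    refine OF.hom_ext fun x => OF.hom_ext fun y => ?_
    simp only [LinearMap.compr₂_apply, concat_single, Finsupp.lapply_apply, LinearMap.sum_apply,
      LinearMap.compl₁₂_apply, LinearMap.mul_apply', Finsupp.single_apply]
    by_cases h : x ++ y = w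
    · subst h
      rw [if_pos rfl, Finset.sum_eq_single x.length]
      · simp
      · intro i hi hne
        rw [Finset.mem_range, List.length_append] at hi
        rw [if_neg, zero_mul]
        intro h
        have := congrArg List.length h
        rw [List.length_take, List.length_append] at this
        omega
      · simp
    · rw [if_neg h, Finset.sum_eq_zero]
      intro i _
      by_cases h1 : x = w.take i
      · rw [if_neg (c := y = w.drop i), mul_zero]
        rintro rfl
        exact h (h1 ▸ List.take_append_drop i w)
      · rw [if_neg h1, zero_mul]
  have := LinearMap.congr_fun (LinearMap.congr_fun e x) y
  simpa [LinearMap.sum_apply] using this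

/-- Both terms of the recursion for `φ(τ · A)` have `|τ| + |A|` vertices. The induction is on the
number of trees, which grafting preserves, and not on the number of vertices. -/
theorem phi_single_apply_of_ne (θ w : Forest C) (h : forestSize w ≠ forestSize θ) :
    phi (Finsupp.single θ 1) w = 0 := by
  suffices H : ∀ (m : ℕ) (θ : Forest C), θ.length = m → ∀ w, forestSize w ≠ forestSize θ →
      phi (Finsupp.single θ 1) w = 0 from H _ θ rfl w h
  classical
  clear h w θ
  intro m
  induction m with
  | zero =>
    intro θ h w hw
    rw [List.length_eq_zero_iff] at h
    subst h
    rw [← emptyForest, phi_emptyForest, emptyForest, Finsupp.single_apply, if_neg]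
    rintro rfl
    exact hw rfl
  | succ m ih =>
    rintro (_ | ⟨τ, θ⟩) h w hw
    · simp at h
    have h : θ.length = m := by simpa using h
    rw [forestSize] at hw
    rw [phi_single_cons, Finsupp.sub_apply, graftTree_single, map_listSum, concat_apply,
      Finset.sum_eq_zero, zero_sub, neg_eq_zero, ← Finsupp.lapply_apply (R := ℝ), map_listSum]
    · refine List.sum_eq_zero fun v hv => ?_
      obtain ⟨θ', hθ', rfl⟩ := List.mem_map.1 hv
      refine ih θ' ((length_of_mem_forestGraft τ hθ').trans h) w ?_
      rwa [forestSize_of_mem_forestGraft τ hθ']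
    · intro i _
      rw [ofTree, Finsupp.single_apply]
      split_ifs with h1
      · rw [ih θ h, mul_zero]
        intro h2
        apply hw
        rw [← List.take_append_drop i w, forestSize_append, ← h1, h2, forestSize, forestSize,
          add_zero]
      · rw [zero_mul]

end Isomorphism

-- The image of a rough path under `φ`

section RoughPath

variable {C : Type*} [Finite C]

@[simp] theorem mem_forests {k : ℕ} {θ : Forest C} : θ ∈ forests C k ↔ forestSize θ = k := by
  simp [forests]

theorem phiForm_single (X : OF C →ₗ[ℝ] ℝ) (w : Forest C) :
    phiForm X (Finsupp.single w 1) =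
      ∑ x ∈ forests C (forestSize w), X (Finsupp.single x 1) * phi (Finsupp.single x 1) w := by
  simp [phiForm]

theorem convolution_single (α β : OF C →ₗ[ℝ] ℝ) (z : Forest C) :
    convolution α β (Finsupp.single z 1) =
      ∑ ij ∈ Finset.HasAntidiagonal.antidiagonal (forestSize z),
        ∑ x ∈ forests C ij.1, ∑ y ∈ forests C ij.2,
          gl (Finsupp.single x 1) (Finsupp.single y 1) z *
            (α (Finsupp.single x 1) * β (Finsupp.single y 1)) := by
  simp [convolution, mkwCoproduct]

theorem phi_apply_eq_sum (v : OF C) (w : Forest C) :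
    phi v w = ∑ z ∈ forests C (forestSize w), v z * phi (Finsupp.single z 1) w := by
  classical
  have e : Finsupp.lapply w ∘ₗ phi = ∑ z ∈ forests C (forestSize w),
      phi (Finsupp.single z 1) w • (Finsupp.lapply z : OF C →ₗ[ℝ] ℝ) := by
    refine OF.hom_ext fun z => ?_
    simp only [LinearMap.comp_apply, Finsupp.lapply_apply, LinearMap.sum_apply,
      LinearMap.smul_apply, Finsupp.single_apply, smul_eq_mul, mul_ite, mul_one, mul_zero,
      Finset.sum_ite_eq, mem_forests]
    split_ifs with h
    · rfl
    · exact phi_single_apply_of_ne _ _ fun h' => h h'.symm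
  have := LinearMap.congr_fun e v
  simpa [LinearMap.sum_apply, mul_comm] using this

/-- Convolution is dual to `∗`, so multiplicativity of `φ` turns it into concatenation of series,
whose coefficient at `w` is a sum over the cuts of `w`. -/
theorem phiForm_convolution (α β : OF C →ₗ[ℝ] ℝ) (w : Forest C) :
    phiForm (convolution α β) (Finsupp.single w 1) = ∑ i ∈ Finset.range (w.length + 1),
      phiForm α (Finsupp.single (w.take i) 1) * phiForm β (Finsupp.single (w.drop i) 1) := by
  have lhs : phiForm (convolution α β) (Finsupp.single w 1) =
      ∑ ij ∈ Finset.HasAntidiagonal.antidiagonal (forestSize w),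
        ∑ x ∈ forests C ij.1, ∑ y ∈ forests C ij.2,
          α (Finsupp.single x 1) * β (Finsupp.single y 1) *
            phi (gl (Finsupp.single x 1) (Finsupp.single y 1)) w := by
    rw [phiForm_single]
    simp only [phi_apply_eq_sum (gl _ _), Finset.mul_sum]
    have : ∀ z ∈ forests C (forestSize w), convolution α β (Finsupp.single z 1) *
        phi (Finsupp.single z 1) w = ∑ ij ∈ Finset.HasAntidiagonal.antidiagonal (forestSize w),
        ∑ x ∈ forests C ij.1, ∑ y ∈ forests C ij.2,
          α (Finsupp.single x 1) * β (Finsupp.single y 1) *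
            (gl (Finsupp.single x 1) (Finsupp.single y 1) z * phi (Finsupp.single z 1) w) := by
      intro z hz
      rw [mem_forests] at hz
      rw [convolution_single, hz]
      simp only [Finset.sum_mul]
      refine Finset.sum_congr rfl fun _ _ => Finset.sum_congr rfl fun _ _ =>
        Finset.sum_congr rfl fun _ _ => by ring
    rw [Finset.sum_congr rfl this, Finset.sum_comm]
    refine Finset.sum_congr rfl fun _ _ => ?_
    rw [Finset.sum_comm]
    refine Finset.sum_congr rfl fun _ _ => ?_
    rw [Finset.sum_comm]
  rw [lhs]
  simp only [phi_gl, concat_apply, Finset.mul_sum]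
  simp only [Finset.sum_comm (s := forests C _) (t := Finset.range _)]
  rw [Finset.sum_comm]
  refine Finset.sum_congr rfl fun i _ => ?_
  have hw : forestSize (w.take i) + forestSize (w.drop i) = forestSize w := by
    rw [← forestSize_append, List.take_append_drop]
  -- For a given cut, homogeneity of `φ` leaves only the pair of degrees of its two factors.
  rw [Finset.sum_eq_single (forestSize (w.take i), forestSize (w.drop i))]
  · rw [phiForm_single, phiForm_single, Finset.sum_mul_sum]
    refine Finset.sum_congr rfl fun _ _ => Finset.sum_congr rfl fun _ _ => by ring
  · rintro ⟨j, k⟩ _ hne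
    refine Finset.sum_eq_zero fun x hx => Finset.sum_eq_zero fun y hy => ?_
    rw [mem_forests] at hx hy
    by_cases h1 : forestSize (w.take i) = forestSize x
    · rw [phi_single_apply_of_ne y, mul_zero, mul_zero]
      intro h2
      exact hne (Prod.ext (hx.symm.trans h1.symm) (hy.symm.trans h2.symm))
    · rw [phi_single_apply_of_ne x _ h1, zero_mul, mul_zero]
  · intro h
    exact absurd (Finset.HasAntidiagonal.mem_antidiagonal.2 hw) h

theorem phi_planarSolution {n : ℕ} (X : OF (Fin n) →ₗ[ℝ] ℝ) (k : ℕ) :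
    phi (planarSolution LinearMap.id X k) =
      ∑ w ∈ forests (Fin n) k, phiForm X (Finsupp.single w 1) • Finsupp.single w 1 := by
  classical
  ext w
  simp only [planarSolution, map_sum, map_smul, LinearMap.id_apply, Finsupp.finsetSum_apply,
    Finsupp.smul_apply, smul_eq_mul, Finsupp.single_apply, mul_ite, mul_one, mul_zero,
    Finset.sum_ite_eq', mem_forests]
  split_ifs with h
  · rw [phiForm_single, h]
  · refine Finset.sum_eq_zero fun x hx => ?_
    rw [phi_single_apply_of_ne, mul_zero]
    rw [mem_forests] at hx
    rwa [hx]

theorem planarSolution_eq_map {n : ℕ} {A : Type*} [AddCommGroup A] [Module ℝ A]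
    (F : OF (Fin n) →ₗ[ℝ] A) (X : OF (Fin n) →ₗ[ℝ] ℝ) (k : ℕ) :
    planarSolution F X k = F (planarSolution LinearMap.id X k) := by
  simp only [planarSolution, map_sum, map_smul, LinearMap.id_apply]

/-- The hypotheses on `Ψ` force its value on a word to be the product of the operators `f` applied
to `y₀`; by `hX`, restricting the letters discards only zero terms. -/
theorem geometricSolution_eq_map {n : ℕ} {A : Type*} [AddCommGroup A] [Module ℝ A]
    {letters : Set (PTree (Fin n))} {f : PTree (Fin n) → Module.End ℝ A} {y₀ : A}
    (X : OF (Fin n) →ₗ[ℝ] ℝ) (k : ℕ) (Ψ : OF (Fin n) →ₗ[ℝ] A) (h_one : Ψ emptyForest = y₀)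
    (h_mul : ∀ τ x, Ψ (concat (ofTree τ) x) = f τ (Ψ x))
    (hX : ∀ w : Forest (Fin n), (∃ τ ∈ w, τ ∉ letters) → phiForm X (Finsupp.single w 1) = 0) :
    geometricSolution letters f y₀ (phiForm X) k = Ψ (phi (planarSolution LinearMap.id X k)) := by
  classical
  have hf (w : Forest (Fin n)) : (w.map f).prod y₀ = Ψ (Finsupp.single w 1) := by
    induction w with
    | nil => simp [← h_one, emptyForest]
    | cons τ w ih =>
      rw [List.map_cons, List.prod_cons, Module.End.mul_apply, ih, ← h_mul, ofTree, concat_single]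
      rfl
  rw [phi_planarSolution, map_sum, geometricSolution, Finset.sum_filter]
  refine Finset.sum_congr rfl fun w _ => ?_
  rw [map_smul, hf]
  split_ifs with h
  · rfl
  · push Not at h
    rw [hX w h, zero_smul]

-- Vanishing on words with a large letter

theorem eq_zero_of_additive_of_bound {a : ℝ → ℝ → ℝ} (h_add : ∀ s u t, a s u + a u t = a s t)
    {p K : ℝ} (hp : 1 < p) (hK : ∀ s t, s ≠ t → |a s t| ≤ K * |t - s| ^ p) (s t : ℝ) :
    a s t = 0 := by
  have h_self (s : ℝ) : a s s = 0 := by have := h_add s s s; linarith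
  -- By additivity the increment of `a s` from `u` to `v` is `a u v`, which is `o(v - u)` since `p >
  -- 1`.
  have hd (u : ℝ) : HasDerivAt (a s) 0 u := by
    rw [hasDerivAt_iff_isLittleO]
    have h1 : (fun v => a s v - a s u - (v - u) • (0 : ℝ)) =O[nhds u] fun v => |v - u| ^ p := by
      refine Asymptotics.IsBigO.of_bound K (Filter.Eventually.of_forall fun v => ?_)
      have e : a s v - a s u - (v - u) • (0 : ℝ) = a u v := by
        rw [smul_zero, sub_zero, ← h_add s u v]; ring
      rw [e, Real.norm_eq_abs, Real.norm_eq_abs, abs_of_nonneg (Real.rpow_nonneg (abs_nonneg _) _)]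
      rcases eq_or_ne u v with rfl | h
      · rw [h_self, sub_self, abs_zero, Real.zero_rpow (by linarith), mul_zero]
      · exact hK u v h
    refine h1.trans_isLittleO ?_
    have h2 : (fun x : ℝ => |x| ^ p) =o[nhds 0] fun x => x := by
      refine Asymptotics.isLittleO_norm_right.1 ?_
      have h3 : (fun x : ℝ => |x| ^ p) = fun x => |x| ^ (p - 1) * ‖x‖ := by
        funext x
        rcases eq_or_ne x 0 with rfl | h
        · simp [Real.zero_rpow (by linarith : p ≠ 0)]
        · rw [Real.norm_eq_abs, ← Real.rpow_add_one (abs_ne_zero.2 h), sub_add_cancel]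
      rw [h3]
      have h4 : (fun x : ℝ => |x| ^ (p - 1)) =o[nhds 0] fun _ => (1 : ℝ) := by
        rw [Asymptotics.isLittleO_one_iff]
        have : ContinuousAt (fun x : ℝ => |x| ^ (p - 1)) 0 :=
          continuous_abs.continuousAt.rpow_const (Or.inr (by linarith))
        simpa [ContinuousAt, Real.zero_rpow (by linarith : p - 1 ≠ 0)] using this
      simpa using h4.mul_isBigO (Asymptotics.isBigO_refl (fun x : ℝ => ‖x‖) (nhds 0))
    have h5 : Filter.Tendsto (fun v => v - u) (nhds u) (nhds 0) := by
      have : ContinuousAt (fun v : ℝ => v - u) u := by fun_prop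
      simpa [ContinuousAt] using this
    exact h2.comp_tendsto h5
  rw [← h_self s]
  exact is_const_of_deriv_eq_zero (fun u => (hd u).differentiableAt) (fun u => (hd u).deriv) t s

theorem PlanarlyBranchedRoughPath.phiForm_bound {n : ℕ} {γ : ℝ}
    (X : PlanarlyBranchedRoughPath n γ) (w : Forest (Fin n)) :
    ∃ K : ℝ, ∀ s t : ℝ, s ≠ t →
      |phiForm (X.form s t) (Finsupp.single w 1)| ≤ K * |t - s| ^ (γ * forestSize w) := by
  choose K hK using X.bound
  refine ⟨∑ x ∈ forests (Fin n) (forestSize w), K x * |phi (Finsupp.single x 1) w|,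
    fun s t hst => ?_⟩
  rw [phiForm_single, Finset.sum_mul]
  refine (Finset.abs_sum_le_sum_abs _ _).trans (Finset.sum_le_sum fun x hx => ?_)
  rw [mem_forests] at hx
  have hpos : 0 < |t - s| ^ (γ * forestSize w) :=
    Real.rpow_pos_of_pos (abs_pos.2 (sub_ne_zero.2 hst.symm)) _
  have := hK x s t hst
  rw [hx, div_le_iff₀ hpos] at this
  rw [abs_mul, mul_right_comm]
  exact mul_le_mul_of_nonneg_right this (abs_nonneg _)

theorem phiForm_nil {X : OF C →ₗ[ℝ] ℝ} (h : X emptyForest = 1) :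
    phiForm X (Finsupp.single [] 1) = 1 := by
  have hf : forests C (forestSize ([] : Forest C)) = {[]} := by
    ext θ
    rw [mem_forests, Finset.mem_singleton]
    rcases θ with _ | ⟨⟨a, η⟩, θ⟩
    · simp
    · simp [forestSize, PTree.size]
  rw [phiForm_single, hf, Finset.sum_singleton, ← emptyForest, h, phi_emptyForest, emptyForest]
  simp

/-- The coefficient of `φ(X)` at a word with a letter of more than `⌊1/γ⌋` vertices vanishes. -/
theorem PlanarlyBranchedRoughPath.phiForm_eq_zero {n : ℕ} {γ : ℝ} (hγ : 0 < γ)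
    (X : PlanarlyBranchedRoughPath n γ) (w : Forest (Fin n))
    (hw : ∃ τ ∈ w, ⌊1 / γ⌋₊ < τ.size) (s t : ℝ) :
    phiForm (X.form s t) (Finsupp.single w 1) = 0 := by
  induction hm : w.length using Nat.strong_induction_on generalizing w s t with
  | _ m ih =>
  obtain ⟨τ, hτ, hsize⟩ := hw
  obtain ⟨K, hK⟩ := X.phiForm_bound w
  have hp : 1 < γ * forestSize w := by
    have h1 : τ.size ≤ forestSize w := by
      obtain ⟨u, v, rfl⟩ := List.append_of_mem hτ
      rw [forestSize_append, forestSize]; omega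
    -- An integer above `⌊1/γ⌋` exceeds `1/γ` itself, which makes the exponent `γ|w|` strictly
    -- larger than one.
    have h2 : 1 / γ < τ.size := (Nat.floor_lt (by positivity)).1 hsize
    have h3 : (τ.size : ℝ) ≤ forestSize w := by exact_mod_cast h1
    rw [mul_comm, ← div_lt_iff₀ hγ]
    exact h2.trans_le h3
  refine eq_zero_of_additive_of_bound (fun s u t => ?_) hp hK s t
  have hl : 0 < w.length := List.length_pos_of_mem hτ
  -- The two extreme cuts are split off; they are distinct because `w` is nonempty. The empty word
  -- has coefficient one, so they contribute the coefficients of `w` over the two subintervals, and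
  -- the interior cuts must vanish.
  rw [← X.chen s u t, phiForm_convolution, Finset.sum_range_succ, ← Nat.succ_pred_eq_of_pos hl,
    Finset.sum_range_succ', Nat.succ_pred_eq_of_pos hl, List.take_length, List.drop_length,
    List.take_zero, List.drop_zero, phiForm_nil (X.map_one _ _), phiForm_nil (X.map_one _ _),
    Finset.sum_eq_zero]
  · ring
  intro i hi
  have hi : i + 1 < w.length := by
    have := Finset.mem_range.1 hi
    rw [Nat.pred_eq_sub_one] at this
    omega
  -- The large letter survives in one of two strictly shorter factors, to which the induction
  -- hypothesis applies.
  have hmem : τ ∈ w.take (i + 1) ∨ τ ∈ w.drop (i + 1) := by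
    rw [← List.mem_append, List.take_append_drop]; exact hτ
  rcases hmem with h | h
  · rw [ih _ _ (w.take (i + 1)) ⟨τ, h, hsize⟩ s u rfl, zero_mul]
    rw [List.length_take]; omega
  · rw [ih _ _ (w.drop (i + 1)) ⟨τ, h, hsize⟩ u t rfl, mul_zero]
    rw [List.length_drop]; omega

end RoughPath

-- Lie-valued functions and elementary differentials

section ElementaryDifferentials

attribute [local instance] LieRing.ofAssociativeRing LieAlgebra.ofAssociativeAlgebra

variable {R L : Type*} [CommRing R] [Algebra ℝ R] [LieRing L] [LieAlgebra ℝ L]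
  (act : L →ₗ⁅ℝ⁆ Module.End ℝ R)

theorem graft_emptyForest_left {C : Type*} (x : OF C) : graft emptyForest x = x := by
  refine LinearMap.congr_fun (OF.hom_ext (f := graft emptyForest)
    (g := LinearMap.id) fun θ => ?_) x
  rw [emptyForest, graft, bilin_single]
  simp

theorem diffOp_tmul (a : R) (u : U L) (h : R) :
    diffOp act (a ⊗ₜ u) h = a * UniversalEnvelopingAlgebra.lift ℝ act u h := rfl

theorem diffOp_one : diffOp act 1 = 1 := by
  refine LinearMap.ext fun h => ?_
  rw [Algebra.TensorProduct.one_def, diffOp_tmul, map_one, one_mul]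

theorem diffOp_tmul_ι (a : R) (l : L) (h : R) :
    diffOp act (a ⊗ₜ UniversalEnvelopingAlgebra.ι ℝ l) h = a * act l h := by
  rw [diffOp_tmul, UniversalEnvelopingAlgebra.lift_ι_apply]

theorem triangle_tmul (X : R ⊗[ℝ] U L) (b : R) (v : U L) :
    triangle act X (b ⊗ₜ v) = diffOp act X b ⊗ₜ v := rfl

theorem triangle_one_left (Y : R ⊗[ℝ] U L) : triangle act 1 Y = Y := by
  rw [triangle, LinearMap.comp_apply, diffOp_one]
  exact LinearMap.congr_fun (LinearMap.rTensor_id (U L) R) Y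

theorem tmul_ι_mem_lieValued (a : R) (l : L) :
    a ⊗ₜ UniversalEnvelopingAlgebra.ι ℝ l ∈ lieValued R L := ⟨a ⊗ₜ l, rfl⟩

theorem lieValued_induction {p : ∀ X : R ⊗[ℝ] U L, X ∈ lieValued R L → Prop}
    (zero : p 0 (zero_mem _)) (add : ∀ X Y hX hY, p X hX → p Y hY → p (X + Y) (add_mem hX hY))
    (tmul : ∀ a l, p (a ⊗ₜ UniversalEnvelopingAlgebra.ι ℝ l) (tmul_ι_mem_lieValued a l))
    {X : R ⊗[ℝ] U L} (hX : X ∈ lieValued R L) : p X hX := by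
  obtain ⟨x, rfl⟩ := hX
  induction x with
  | zero => simpa using zero
  | add x y hx hy => simpa using add _ _ _ _ hx hy
  | tmul a l => exact tmul a l

theorem triangle_mem_lieValued (X : R ⊗[ℝ] U L) {Y : R ⊗[ℝ] U L} (hY : Y ∈ lieValued R L) :
    triangle act X Y ∈ lieValued R L := by
  induction hY using lieValued_induction with
  | zero => rw [map_zero]; exact zero_mem _
  | add X Y _ _ hX hY => rw [map_add]; exact add_mem hX hY
  | tmul a l => rw [triangle_tmul]; exact tmul_ι_mem_lieValued _ l

/-- Elements of `L` are primitive in `U(L)`: this is the counterpart of `gl_ofTree`. -/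
theorem star_of_mem_lieValued {X : R ⊗[ℝ] U L} (hX : X ∈ lieValued R L) (Y : R ⊗[ℝ] U L) :
    star act X Y = X * Y + triangle act X Y := by
  induction hX using lieValued_induction with
  | zero => simp
  | add X X' _ _ hX hX' => simp only [map_add, LinearMap.add_apply, hX, hX', add_mul]; abel
  | tmul a l =>
    have h1 : star act (a ⊗ₜ UniversalEnvelopingAlgebra.ι ℝ l) Y =
        a ⊗ₜ 1 * starConst act (UniversalEnvelopingAlgebra.ι ℝ l) Y := rfl
    have h2 : starConst act (UniversalEnvelopingAlgebra.ι ℝ l) Y =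
        1 ⊗ₜ UniversalEnvelopingAlgebra.ι ℝ l * Y +
          triangle act (1 ⊗ₜ UniversalEnvelopingAlgebra.ι ℝ l) Y := by
      have e : envCoproduct L (UniversalEnvelopingAlgebra.ι ℝ l) =
          UniversalEnvelopingAlgebra.ι ℝ l ⊗ₜ[ℝ] 1 + 1 ⊗ₜ[ℝ] UniversalEnvelopingAlgebra.ι ℝ l :=
        UniversalEnvelopingAlgebra.lift_ι_apply ..
      have h3 (u v : U L) : TensorProduct.lift
          ((LinearMap.mul ℝ (Module.End ℝ (R ⊗[ℝ] U L))).compl₁₂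
            ((Algebra.lmul ℝ (R ⊗[ℝ] U L)).toLinearMap ∘ₗ TensorProduct.mk ℝ R (U L) 1)
            (triangle act ∘ₗ TensorProduct.mk ℝ R (U L) 1)) (u ⊗ₜ v) Y =
          (1 ⊗ₜ u) * triangle act (1 ⊗ₜ v) Y := rfl
      rw [starConst, LinearMap.comp_apply, AlgHom.toLinearMap_apply, e, map_add,
        LinearMap.add_apply, h3, h3, ← Algebra.TensorProduct.one_def, triangle_one_left, one_mul]
    rw [h1, h2, mul_add, ← mul_assoc, Algebra.TensorProduct.tmul_mul_tmul, mul_one, one_mul]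
    congr 1
    clear h1 h2
    induction Y with
    | zero => simp
    | add Y Y' hY hY' => simp only [map_add, mul_add, hY, hY']
    | tmul b v =>
      rw [triangle_tmul, triangle_tmul, Algebra.TensorProduct.tmul_mul_tmul, diffOp_tmul_ι,
        diffOp_tmul_ι, one_mul, one_mul]

variable {act} (hact : ∀ l a b, act l (a * b) = act l a * b + a * act l b)
include hact

theorem triangle_mul {X : R ⊗[ℝ] U L} (hX : X ∈ lieValued R L) (Y Z : R ⊗[ℝ] U L) :
    triangle act X (Y * Z) = triangle act X Y * Z + Y * triangle act X Z := by
  induction hX using lieValued_induction with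
  | zero => simp
  | add X X' _ _ hX hX' => simp only [map_add, LinearMap.add_apply, hX, hX', add_mul, mul_add]; abel
  | tmul a l =>
    induction Y with
    | zero => simp
    | add Y Y' hY hY' => simp only [map_add, add_mul, hY, hY']; abel
    | tmul b v =>
      induction Z with
      | zero => simp
      | add Z Z' hZ hZ' => simp only [map_add, mul_add, hZ, hZ']; abel
      | tmul c w =>
        simp only [Algebra.TensorProduct.tmul_mul_tmul, triangle_tmul, diffOp_tmul_ι, hact,
          ← TensorProduct.add_tmul]
        congr 1
        ring

/-- Leibniz for the vector field `a l` applied to `b · (v h)`: the term differentiating `v h` comes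
from `X * Y`, the term differentiating `b` from `X ▷ Y`. Thus `∗` becomes composition of
differential operators. -/
theorem diffOp_mul_add_triangle {X : R ⊗[ℝ] U L} (hX : X ∈ lieValued R L) (Y : R ⊗[ℝ] U L) :
    diffOp act (X * Y + triangle act X Y) = diffOp act X * diffOp act Y := by
  induction hX using lieValued_induction with
  | zero => simp
  | add X X' _ _ hX hX' =>
    simp only [map_add, LinearMap.add_apply, add_mul] at hX hX' ⊢
    rw [← hX, ← hX']
    abel
  | tmul a l =>
    induction Y with
    | zero => simp
    | add Y Y' hY hY' =>
      simp only [map_add, mul_add] at hY hY' ⊢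
      rw [← hY, ← hY']
      abel
    | tmul b v =>
      refine LinearMap.ext fun h => ?_
      rw [map_add, LinearMap.add_apply, Module.End.mul_apply, Algebra.TensorProduct.tmul_mul_tmul,
        triangle_tmul, diffOp_tmul, diffOp_tmul, diffOp_tmul_ι, diffOp_tmul_ι, diffOp_tmul, hact,
        map_mul, Module.End.mul_apply, UniversalEnvelopingAlgebra.lift_ι_apply]
      ring

theorem triangle_mul_add_triangle {X : R ⊗[ℝ] U L} (hX : X ∈ lieValued R L)
    (Y Z : R ⊗[ℝ] U L) :
    triangle act (X * Y + triangle act X Y) Z = triangle act X (triangle act Y Z) := by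
  have h := diffOp_mul_add_triangle hact hX Y
  rw [triangle, LinearMap.comp_apply, ← triangle, h]
  exact LinearMap.congr_fun (LinearMap.rTensor_mul (U L) (diffOp act X) (diffOp act Y)) Z

theorem triangle_one_right {X : R ⊗[ℝ] U L} (hX : X ∈ lieValued R L) : triangle act X 1 = 0 := by
  have h := triangle_mul hact hX 1 1
  simpa using h

variable {C : Type*} {f : C → R ⊗[ℝ] U L} (hf : ∀ a, f a ∈ lieValued R L)

omit hact in
theorem elementaryDifferential_single (θ : Forest C) :
    elementaryDifferential act f (Finsupp.single θ 1) = forestDifferential act f θ := by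
  simp [elementaryDifferential]

omit hact in
theorem elementaryDifferential_emptyForest : elementaryDifferential act f emptyForest = 1 := by
  rw [emptyForest, elementaryDifferential_single, forestDifferential]

omit hact in
theorem elementaryDifferential_ofTree (τ : PTree C) :
    elementaryDifferential act f (ofTree τ) = treeDifferential act f τ := by
  rw [ofTree, elementaryDifferential_single, forestDifferential, forestDifferential, mul_one]

omit hact in
theorem elementaryDifferential_concat (x y : OF C) :
    elementaryDifferential act f (concat x y) =
      elementaryDifferential act f x * elementaryDifferential act f y := by
  have e : concat.compr₂ (elementaryDifferential act f) =
      (LinearMap.mul ℝ _).compl₁₂ (elementaryDifferential act f) (elementaryDifferential act f) := by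
    refine OF.hom_ext fun x => OF.hom_ext fun y => ?_
    simp only [LinearMap.compr₂_apply, concat_single, LinearMap.compl₁₂_apply,
      LinearMap.mul_apply', elementaryDifferential_single]
    induction x with
    | nil => simp [forestDifferential]
    | cons t x ih => rw [List.cons_append, forestDifferential, ih, forestDifferential, mul_assoc]
  exact LinearMap.congr_fun (LinearMap.congr_fun e x) y

omit hact in
theorem elementaryDifferential_addRoot (a : C) (x : OF C) :
    elementaryDifferential act f (addRoot a x) =
      triangle act (elementaryDifferential act f x) (f a) := by
  refine LinearMap.congr_fun (OF.hom_ext (f := elementaryDifferential act f ∘ₗ addRoot a)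
    (g := (triangle act).flip (f a) ∘ₗ elementaryDifferential act f) fun x => ?_) x
  simp only [LinearMap.comp_apply, addRoot_single, elementaryDifferential_ofTree,
    treeDifferential, LinearMap.flip_apply, elementaryDifferential_single]

include hf

omit hact in
theorem elementaryDifferential_ofTree_mem (τ : PTree C) :
    elementaryDifferential act f (ofTree τ) ∈ lieValued R L := by
  obtain ⟨a, θ⟩ := τ
  rw [elementaryDifferential_ofTree, treeDifferential]
  exact triangle_mem_lieValued act _ (hf a)

/-- Both sides are derivations in the forest, which reduces the claim to one tree `B₊ᵃ(θ)`. There `τ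
▷ B₊ᵃ(θ) = B₊ᵃ(τ ∗ θ)`, and the induction hypothesis on `θ` identifies `F(τ ∗ θ) ▷ f_a` with `F(τ) ▷
(F(θ) ▷ f_a)`. -/
theorem elementaryDifferential_graftTree_single (τ : PTree C) : ∀ θ : Forest C,
    elementaryDifferential act f (graftTree τ (Finsupp.single θ 1)) =
      triangle act (elementaryDifferential act f (ofTree τ))
        (elementaryDifferential act f (Finsupp.single θ 1))
  | [] => by
    rw [← emptyForest, graftTree_emptyForest, map_zero, elementaryDifferential_emptyForest,
      triangle_one_right hact (elementaryDifferential_ofTree_mem hf τ)]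
  | .node a θ :: θ' => by
    have hτ := elementaryDifferential_ofTree_mem (act := act) hf τ
    have e : (Finsupp.single (.node a θ :: θ') 1 : OF C) =
        concat (addRoot a (Finsupp.single θ 1)) (Finsupp.single θ' 1) := by
      simp [addRoot_single, ofTree]
    rw [e, graftTree_concat, map_add, elementaryDifferential_concat, elementaryDifferential_concat,
      elementaryDifferential_concat, triangle_mul hact hτ,
      elementaryDifferential_graftTree_single τ θ', graftTree_addRoot,
      elementaryDifferential_addRoot, elementaryDifferential_addRoot, gl_ofTree,
      LinearMap.add_apply, map_add, elementaryDifferential_graftTree_single τ θ,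
      elementaryDifferential_concat, triangle_mul_add_triangle hact hτ]

theorem elementaryDifferential_graftTree (τ : PTree C) (x : OF C) :
    elementaryDifferential act f (graftTree τ x) =
      triangle act (elementaryDifferential act f (ofTree τ)) (elementaryDifferential act f x) :=
  LinearMap.congr_fun (OF.hom_ext (f := elementaryDifferential act f ∘ₗ graftTree τ)
    (g := triangle act (elementaryDifferential act f (ofTree τ)) ∘ₗ elementaryDifferential act f)
    (elementaryDifferential_graftTree_single hact hf τ)) x

theorem elementaryDifferential_gl (τ : PTree C) (x : OF C) :
    elementaryDifferential act f (gl (ofTree τ) x) =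
      elementaryDifferential act f (ofTree τ) * elementaryDifferential act f x +
        triangle act (elementaryDifferential act f (ofTree τ))
          (elementaryDifferential act f x) := by
  rw [gl_ofTree, LinearMap.add_apply, map_add, elementaryDifferential_concat,
    elementaryDifferential_graftTree hact hf]

/-- Induction over `∗`-products of trees: left multiplication by a tree becomes an iterated `▷` on
both sides. -/
theorem elementaryDifferential_graft (x y : OF C) :
    elementaryDifferential act f (graft x y) =
      triangle act (elementaryDifferential act f x) (elementaryDifferential act f y) := by
  induction x using gl_induction with
  | zero => simp
  | add x x' hx hx' => simp only [map_add, LinearMap.add_apply, hx, hx']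
  | smul c x hx => simp only [map_smul, LinearMap.smul_apply, hx]
  | one => rw [graft_emptyForest_left, elementaryDifferential_emptyForest, triangle_one_left]
  | mul τ x hx =>
    rw [graft_gl, elementaryDifferential_graftTree hact hf, hx, elementaryDifferential_gl hact hf,
      triangle_mul_add_triangle hact (elementaryDifferential_ofTree_mem hf τ)]

theorem isDAlgebraMorphism_elementaryDifferential :
    IsDAlgebraMorphism act f (elementaryDifferential act f) where
  map_vertex a := by
    rw [elementaryDifferential_ofTree, treeDifferential, forestDifferential, triangle_one_left]
  map_one := elementaryDifferential_emptyForest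
  map_concat := elementaryDifferential_concat
  map_graft := elementaryDifferential_graft hact hf
  map_tree := elementaryDifferential_ofTree_mem hf

end ElementaryDifferentials

-- The infinitesimal action by derivations

section HomogeneousSpace

variable {E : Type*} [NormedAddCommGroup E] [NormedSpace ℝ E] [FiniteDimensional ℝ E]
  {G : Type*} [TopologicalSpace G] [ChartedSpace E G] [Group G] [LieGroup 𝓘(ℝ, E) ∞ G]
  {F : Type*} [NormedAddCommGroup F] [NormedSpace ℝ F]
  {M : Type*} [TopologicalSpace M] [ChartedSpace F M] [IsManifold 𝓘(ℝ, F) ∞ M]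
  [MulAction G M] [ContMDiffSMul 𝓘(ℝ, E) 𝓘(ℝ, F) ∞ G M]

theorem infinitesimalAction_mul (x : GroupLieAlgebra 𝓘(ℝ, E) G) (f h : C^∞⟮𝓘(ℝ, F), M; ℝ⟯) :
    infinitesimalAction x (f * h) = infinitesimalAction x f * h + f * infinitesimalAction x h := by
  ext p
  have e := congrArg (fun L => L x) (mvfderiv_mul
    ((contMDiff_orbit (E := E) (G := G) f p).mdifferentiable (by simp) 1)
    ((contMDiff_orbit (E := E) (G := G) h p).mdifferentiable (by simp) 1))
  refine Eq.trans e ?_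
  change f ((1 : G)⁻¹ • p) * actionDeriv x h p + h ((1 : G)⁻¹ • p) * actionDeriv x f p =
    actionDeriv x f p * h p + f p * actionDeriv x h p
  rw [inv_one, one_smul]
  ring

omit [IsManifold 𝓘(ℝ, F) ∞ M] [MulAction G M] [ContMDiffSMul 𝓘(ℝ, E) 𝓘(ℝ, F) ∞ G M] in
theorem ofLieValuedMap_mem (f : C^∞⟮𝓘(ℝ, F), M; 𝓘(ℝ, E), E⟯) :
    ofLieValuedMap (G := G) f ∈ lieValued C^∞⟮𝓘(ℝ, F), M; ℝ⟯ (GroupLieAlgebra 𝓘(ℝ, E) G) :=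
  sum_mem fun _ _ => tmul_ι_mem_lieValued _ _

end HomogeneousSpace

end PlanarRP

end

-- Assembly of the four identities

theorem mainTheorem11
    {E : Type*} [NormedAddCommGroup E] [NormedSpace ℝ E] [FiniteDimensional ℝ E]
    {G : Type*} [TopologicalSpace G] [ChartedSpace E G] [Group G] [LieGroup 𝓘(ℝ, E) ∞ G]
    {F : Type*} [NormedAddCommGroup F] [NormedSpace ℝ F] [FiniteDimensional ℝ F]
    {M : Type*} [TopologicalSpace M] [ChartedSpace F M] [IsManifold 𝓘(ℝ, F) ∞ M]
    [MulAction G M] [ContMDiffSMul 𝓘(ℝ, E) 𝓘(ℝ, F) ∞ G M] [MulAction.IsPretransitive G M]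
    (n : ℕ) (f : Fin n → C^∞⟮𝓘(ℝ, F), M; 𝓘(ℝ, E), E⟯)
    (γ : ℝ) (hγ₀ : 0 < γ) (hγ₁ : γ ≤ 1) (X : PlanarRP.PlanarlyBranchedRoughPath n γ) :
    PlanarRP.IsGLIsomorphism (PlanarRP.phi (C := Fin n)) ∧
    PlanarRP.IsDAlgebraMorphism PlanarRP.infinitesimalAction
      (fun i => PlanarRP.ofLieValuedMap (f i)) (PlanarRP.flowMap G f) ∧
    ∀ letters : Set (PlanarRP.PTree (Fin n)), {τ | τ.size ≤ ⌊1 / γ⌋₊} ⊆ letters →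
      ∀ (s t : ℝ) (k : ℕ),
        -- in `C^∞(M, U(𝔤))`
        PlanarRP.planarSolution (PlanarRP.flowMap G f) (X.form s t) k =
            PlanarRP.geometricSolution letters
              (fun τ => PlanarRP.star PlanarRP.infinitesimalAction
                (PlanarRP.flowMap G f (PlanarRP.ofTree τ)))
              1 (PlanarRP.phiForm (X.form s t)) k ∧
        -- applied to a function `ψ` at an initial value `y₀`
        (∀ (ψ : C^∞⟮𝓘(ℝ, F), M; ℝ⟯) (y₀ : M),
          PlanarRP.diffOp PlanarRP.infinitesimalAction
              (PlanarRP.planarSolution (PlanarRP.flowMap G f) (X.form s t) k) ψ y₀ =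
            PlanarRP.geometricSolution letters
              (fun τ => PlanarRP.diffOp PlanarRP.infinitesimalAction
                (PlanarRP.flowMap G f (PlanarRP.ofTree τ)))
              ψ (PlanarRP.phiForm (X.form s t)) k y₀) ∧
        -- in the Grossman-Larson algebra
        PlanarRP.planarSolution LinearMap.id (X.form s t) k =
            PlanarRP.geometricSolution letters (fun τ => PlanarRP.gl (PlanarRP.ofTree τ))
              PlanarRP.emptyForest (PlanarRP.phiForm (X.form s t)) k ∧
        -- in the tensor algebra over the planar trees
        PlanarRP.phi (PlanarRP.planarSolution LinearMap.id (X.form s t) k) =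
            PlanarRP.geometricSolution letters (fun τ => PlanarRP.concat (PlanarRP.ofTree τ))
              PlanarRP.emptyForest (PlanarRP.phiForm (X.form s t)) k := by
  have hact := PlanarRP.infinitesimalAction_mul (E := E) (G := G) (F := F) (M := M)
  have hf (i : Fin n) := PlanarRP.ofLieValuedMap_mem (G := G) (f i)
  refine ⟨PlanarRP.isGLIsomorphism_phi,
    PlanarRP.isDAlgebraMorphism_elementaryDifferential hact hf, fun letters hl s t k => ?_⟩
  have hX (w : PlanarRP.Forest (Fin n)) (hw : ∃ τ ∈ w, τ ∉ letters) :
      PlanarRP.phiForm (X.form s t) (Finsupp.single w 1) = 0 := by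
    obtain ⟨τ, hτ, hτl⟩ := hw
    -- A letter outside `Λ` has more than `⌊1/γ⌋` vertices.
    exact X.phiForm_eq_zero hγ₀ w ⟨τ, hτ, not_le.1 fun h => hτl (hl h)⟩ s t
  have hmem (τ : PlanarRP.PTree (Fin n)) :=
    PlanarRP.elementaryDifferential_ofTree_mem (act := PlanarRP.infinitesimalAction) hf τ
  refine ⟨?_, fun ψ y₀ => ?_, ?_, ?_⟩
  · rw [PlanarRP.planarSolution_eq_map, PlanarRP.geometricSolution_eq_map (X.form s t) k
      (PlanarRP.flowMap G f ∘ₗ PlanarRP.phiInv) ?_ (fun τ x => ?_) hX, LinearMap.comp_apply,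
      PlanarRP.phiInv_phi]
    · rw [LinearMap.comp_apply, PlanarRP.phiInv_emptyForest]
      exact PlanarRP.elementaryDifferential_emptyForest
    · rw [LinearMap.comp_apply, PlanarRP.phiInv_concat_ofTree, PlanarRP.flowMap,
        PlanarRP.elementaryDifferential_gl hact hf,
        PlanarRP.star_of_mem_lieValued _ (hmem τ), LinearMap.comp_apply]
  -- The identity is proved between functions on `M`, before evaluation at `y₀`: here `Ψ` sends a
  -- word to the corresponding differential operator applied to `ψ`.
  · rw [PlanarRP.planarSolution_eq_map, PlanarRP.geometricSolution_eq_map (X.form s t) k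
      (LinearMap.applyₗ ψ ∘ₗ PlanarRP.diffOp PlanarRP.infinitesimalAction ∘ₗ
        PlanarRP.flowMap G f ∘ₗ PlanarRP.phiInv) ?_ (fun τ x => ?_) hX]
    · simp only [LinearMap.comp_apply, PlanarRP.phiInv_phi, LinearMap.applyₗ_apply_apply]
    · simp only [LinearMap.comp_apply, PlanarRP.phiInv_emptyForest, PlanarRP.flowMap,
        PlanarRP.elementaryDifferential_emptyForest, PlanarRP.diffOp_one]
      rfl
    · simp only [LinearMap.comp_apply, PlanarRP.phiInv_concat_ofTree, PlanarRP.flowMap]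
      rw [PlanarRP.elementaryDifferential_gl hact hf,
        PlanarRP.diffOp_mul_add_triangle hact (hmem τ)]
      rfl
  · rw [PlanarRP.geometricSolution_eq_map (X.form s t) k PlanarRP.phiInv
      PlanarRP.phiInv_emptyForest PlanarRP.phiInv_concat_ofTree hX, PlanarRP.phiInv_phi]
  · rw [PlanarRP.geometricSolution_eq_map (X.form s t) k LinearMap.id (y₀ := PlanarRP.emptyForest)
      rfl (fun _ _ => rfl) hX]
    rfl
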